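/- **Model and notation.** In the deterministic $\mathsf{LOCAL}$ model a network is a finite simple graph $G$ with $n$ nodes and maximum degree at most $\Delta$, whose nodes have unique identifiers from $\{1,\dots,n^c\}$, where $c\ge 1$ is a constant integer. Initially a node knows $n$, $\Delta$, its identifier, its degree and its private input (if any). In each synchronous round it sends messages of unbounded size to its neighbors, receives their messages and performs an unbounded local computation. An algorithm solves a problem in $R$ rounds if the local outputs of the nodes after $R$ rounds form a correct solution, on every such network and for all admissible inputs. A $(p:q)$-coloring of $G$ assigns to each node $v$ a set $X_v\subseteq\{1,\dots,p\}$ with $|X_v|\ge q$ such that $X_u\cap X_v=\emptyset$ for every edge $\{u,v\}$; its support is $p$, and it is a fractional $x$-coloring if $p/q\le x$. In the $(\mathrm{degree}+1)$-list coloring problem each node $v$ has a list of at least $\deg(v)+1$ arbitrary colors, and a proper coloring that gives each node a color from its list has to be found. Finally, $\log^* n$ is the number of times that $\log_2$ has to be applied to $n$ until the value is at most $1$, and $\log^+x=\max(0,\log x)$. **Theorem.** Let $c,C\ge 1$ be integers. There is a constant $K>0$, depending only on $c$ and $C$, such that the following holds for all integers $n\ge 0$, $\Delta\ge 3$ and $T\ge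 0$ for which some deterministic $\mathsf{LOCAL}$ algorithm solves the $(\mathrm{degree}+1)$-list coloring problem in $T$ rounds on the networks with $n$ nodes and maximum degree at most $\Delta$, when a proper coloring with $C\Delta^2$ colors is given as part of the input. 1. For every integer $q>0$, with $\alpha = 1+\log_\Delta q$, a $(q\Delta : q-1)$-coloring can be computed by a deterministic $\mathsf{LOCAL}$ algorithm in at most $$K\left(\alpha^2\cdot\log\Delta\cdot T+\alpha\cdot\log^* n\right)$$ rounds on the networks with $n$ nodes and maximum degree at most $\Delta$ that, in case $q\ge\Delta+2$, do not contain the complete graph $K_{\Delta+1}$. 2. For every real $0<\varepsilon\le\Delta$ there is an integer $q\ge 2$ with $\Delta/\varepsilon\le q\le K\Delta/\varepsilon$ such that $\frac{q\Delta}{q-1}\le\Delta+\varepsilon$ and $q\Delta\le K\Delta^2/\varepsilon$, and such that a $(q\Delta:q-1)$-coloring, that is, a fractional $(\Delta+\varepsilon)$-coloring with support $O(\Delta^2/\varepsilon)$, can be computed by a deterministic $\mathsf{LOCAL}$ algorithm in at most $$K\left(\left(\log\Delta+\frac{(\log^+(1/\varepsilon))^2}{\log\Delta}\right)\cdot T+\left(1+\frac{\log^+(1/\varepsilon)}{\log\Delta}\right)\cdot\log^*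 n\right)$$ rounds on the networks with $n$ nodes and maximum degree at most $\Delta$ that, in case $\varepsilon<1$, do not contain $K_{\Delta+1}$. -/

import Mathlib

/-- The iterated logarithm `log* n`: how many times `log₂` has to be applied, starting from `n`,
until the value is at most `1`. -/
noncomputable def logStar (n : ℕ) : ℕ :=
  sInf {k : ℕ | (Real.logb 2)^[k] (n : ℝ) ≤ 1}

/-- A deterministic algorithm in the LOCAL model, with a private input from `In` and a local output
in `Out` at every node.  Messages and local computation are unbounded.
Initially a node knows the number `n` of nodes, the degree bound `Δ`, its own identifier, its own
degree and its own input.  In every round it sends a message to each neighbor (possibly different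
messages to different neighbors, addressed by identifier) and updates its state from the messages
received, each of which is labelled with the identifier of its sender. -/
structure LocalAlgorithm (In Out : Type) where
  State : Type
  Msg : Type
  init : (n Δ ident degree : ℕ) → In → State
  send : State → (receiver : ℕ) → Msg
  receive : State → (inbox : ℕ → Option Msg) → State
  output : State → Out

namespace LocalAlgorithm

variable {In Out : Type} (A : LocalAlgorithm In Out) {V : Type} [Fintype V]

open Classical in
/-- The messages that `v` receives when the nodes are in the states `s`: the entry at `i` is the
message of the neighbor of `v` with identifier `i`, if there is one. -/
noncomputable def inbox (G : SimpleGraph V) (ident : V → ℕ) (s : V → A.State) (v : V) :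
    ℕ → Option A.Msg := fun i =>
  if h : ∃ u, G.Adj v u ∧ ident u = i then some (A.send (s h.choose) (ident v)) else none

/-- The states of all nodes after a given number of synchronous rounds. -/
noncomputable def stateAfter (n Δ : ℕ) (G : SimpleGraph V) [DecidableRel G.Adj] (ident : V → ℕ)
    (x : V → In) : ℕ → V → A.State
  | 0 => fun v => A.init n Δ (ident v) (G.degree v) (x v)
  | t + 1 => fun v =>
      A.receive (stateAfter n Δ G ident x t v) (A.inbox G ident (stateAfter n Δ G ident x t) v)

/-- The local outputs after `T` synchronous rounds. -/
noncomputable def run (n Δ : ℕ) (G : SimpleGraph V) [DecidableRel G.Adj] (ident : V → ℕ)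
    (x : V → In) (T : ℕ) (v : V) : Out :=
  A.output (A.stateAfter n Δ G ident x T v)

end LocalAlgorithm

/-- `G` is a network with `n` nodes and maximum degree at most `Δ`, and `ident` assigns to its nodes
unique identifiers from `{1, …, n ^ c}`. -/
structure IsNetwork (c n Δ : ℕ) {V : Type} [Fintype V] (G : SimpleGraph V) [DecidableRel G.Adj]
    (ident : V → ℕ) : Prop where
  card_eq : Fintype.card V = n
  maxDegree_le : G.maxDegree ≤ Δ
  ident_mem : ∀ v, ident v ∈ Finset.Icc 1 (n ^ c)
  ident_injective : Function.Injective ident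

/-- `col` is a proper coloring of `G` with colors from `{1, …, m}`. -/
def IsProperColoring {V : Type} (G : SimpleGraph V) (m : ℕ) (col : V → ℕ) : Prop :=
  (∀ v, col v ∈ Finset.Icc 1 m) ∧ ∀ u v, G.Adj u v → col u ≠ col v

/-- `col` is a proper coloring of `G` in which each node has a color from its list. -/
def IsListColoring {V : Type} (G : SimpleGraph V) (L : V → Finset ℕ) (col : V → ℕ) : Prop :=
  (∀ v, col v ∈ L v) ∧ ∀ u v, G.Adj u v → col u ≠ col v

/-- `X` is a `(p : q)`-coloring of `G`. -/
def IsMulticoloring {V : Type} (G : SimpleGraph V) (p q : ℕ) (X : V → Finset ℕ) : Prop :=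
  (∀ v, X v ⊆ Finset.Icc 1 p) ∧ (∀ v, q ≤ (X v).card) ∧ ∀ u v, G.Adj u v → Disjoint (X u) (X v)

/-- The (degree+1)-list coloring problem, given a proper coloring with `m` colors, is solved by a
deterministic LOCAL algorithm in `T` rounds on all networks with `n` nodes and maximum degree at
most `Δ`.  The input of a node consists of its given color and of its list. -/
def ListColoringInTime (c m n Δ T : ℕ) : Prop :=
  ∃ A : LocalAlgorithm (ℕ × Finset ℕ) ℕ,
    ∀ (V : Type) [Fintype V] (G : SimpleGraph V) [DecidableRel G.Adj] (ident : V → ℕ)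
      (col : V → ℕ) (L : V → Finset ℕ),
      IsNetwork c n Δ G ident → IsProperColoring G m col →
      (∀ v, G.degree v + 1 ≤ (L v).card) →
      IsListColoring G L (A.run n Δ G ident (fun v => (col v, L v)) T)

/-- A `(p : q)`-coloring is computed by a deterministic LOCAL algorithm, without private inputs, in
`R` rounds on all networks with `n` nodes and maximum degree at most `Δ`; if the condition `excl`
holds, then only on those that do not contain the complete graph on `Δ + 1` nodes. -/
def MulticoloringInTime (c n Δ p q : ℕ) (excl : Prop) (R : ℕ) : Prop :=
  ∃ A : LocalAlgorithm Unit (Finset ℕ),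
    ∀ (V : Type) [Fintype V] (G : SimpleGraph V) [DecidableRel G.Adj] (ident : V → ℕ),
      IsNetwork c n Δ G ident → (excl → G.CliqueFree (Δ + 1)) →
      IsMulticoloring G p q (A.run n Δ G ident (fun _ => ()) R)

/-! The `q * Δ` colors are cut into `q` blocks of `Δ` colors. Every node gets a label and sits out
at most one block, the one with its label, so it ends up with at least `q - 1` colors. What remains,
for each block `i` and for all blocks in parallel, is a `Δ`-coloring of the nodes whose label is not
`i`.

Such a coloring is easy if every node has a nearby sink, that is, a node that need not be colored.
Nodes are colored in the order of decreasing distance to the sinks. Each of them has a neighbor that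
is still uncolored, so its free colors outnumber its active neighbors and the (degree+1)-list
coloring algorithm applies to each layer.

The sinks come from a ruling set whose members are more than `2 * r + 1` apart, with `r = 4 *
Nat.clog Δ q`. If the ball of radius `r` around a member has at least `q` nodes, all labels are
distributed in it and it contains a sink for every block. If it has fewer nodes, the member is poor:
it serves as a sink, and the hole that it leaves is filled afterwards by recoloring its ball
(`exists_recoloring`).

That a small ball can be recolored is the combinatorial core. A hole moves along an edge by taking
over the color of the neighbor. If it can never be filled, then wherever it stands its neighbors
carry each of the `Δ` colors exactly once (`IsHoleColoring.image_eq`, `IsHoleColoring.injOn`).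
Moving the hole around a cycle on which its starting point has no chord shifts the colors, and this
invariant excludes even cycles of that kind and most configurations of odd ones
(`IsHoleColoring.even_cycle`, `IsStuck.theta`). The ball is then so close to a tree that every node
has at least `Δ - 1` grandchildren (`IsStuck.card_grandchildren`), unless there is a `K_{Δ+1}`. Its
exponential growth contradicts having fewer than `q` nodes. For `q ≤ Δ + 1` a node with its `Δ`
neighbors is already too much, which is why cliques are harmless there.

The symmetry breaking is Linial's color reduction on powers of the network, with `O(logStar n)`
reductions. Ruling set members are separated by `O(α)`, and the colors of that power have `O(α log
Δ)` bits. Hence sinks lie within `O(α² log Δ)`, and each layer costs `O(T)` rounds. Additive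
constants are absorbed because list coloring needs `1 ≤ T` once `2 ≤ n`. -/

/-! ### Colorings with a hole -/

/-- No coloring of `H` with the colors `1, …, Δ` agrees with `φ₀` outside `W`. -/
structure IsRigid {V : Type} (H : SimpleGraph V) (Δ : ℕ) (W : Set V) (φ₀ : V → ℕ) : Prop where
  degree_le : ∀ v, (H.neighborSet v).ncard ≤ Δ
  no_extension : ¬ ∃ ψ : V → ℕ, (∀ v, ψ v ∈ Finset.Icc 1 Δ) ∧ (∀ u v, H.Adj u v → ψ u ≠ ψ v) ∧
    ∀ v, v ∉ W → ψ v = φ₀ v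

/-- `φ` is a coloring of `H` without the node `x ∈ W` that agrees with `φ₀` outside `W`.  The value
at `x` is irrelevant. -/
structure IsHoleColoring {V : Type} (H : SimpleGraph V) (Δ : ℕ) (W : Set V) (φ₀ : V → ℕ)
    (x : V) (φ : V → ℕ) : Prop where
  mem : x ∈ W
  mem_Icc : ∀ v, φ v ∈ Finset.Icc 1 Δ
  ne_of_adj : ∀ u v, u ≠ x → v ≠ x → H.Adj u v → φ u ≠ φ v
  eq_off : ∀ v, v ∉ W → φ v = φ₀ v

section Hole

variable {V : Type} {H : SimpleGraph V} {Δ : ℕ} {W : Set V} {φ₀ : V → ℕ}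

/-- A color missing around the hole could be given to it, contradicting rigidity. With degree at
most `Δ`, the neighbors must therefore carry pairwise different colors. -/
theorem IsHoleColoring.image_eq (hR : IsRigid H Δ W φ₀) {x : V} {φ : V → ℕ}
    (h : IsHoleColoring H Δ W φ₀ x φ) : φ '' H.neighborSet x = ↑(Finset.Icc 1 Δ) := by
  classical
  refine Set.Subset.antisymm ?_ ?_
  · rintro _ ⟨v, -, rfl⟩
    exact h.mem_Icc v
  · intro a ha
    by_contra hna
    refine hR.no_extension ⟨Function.update φ x a, ?_, ?_, ?_⟩
    · intro v
      by_cases hv : v = x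
      · subst hv; simpa using ha
      · simpa [Function.update_of_ne hv] using h.mem_Icc v
    · intro u v huv
      by_cases hu : u = x
      · subst hu
        have hv : v ≠ u := huv.ne'
        rw [Function.update_self, Function.update_of_ne hv]
        rintro rfl
        exact hna ⟨v, huv, rfl⟩
      · by_cases hv : v = x
        · subst hv
          rw [Function.update_self, Function.update_of_ne hu]
          rintro rfl
          exact hna ⟨u, huv.symm, rfl⟩
        · rw [Function.update_of_ne hu, Function.update_of_ne hv]
          exact h.ne_of_adj u v hu hv huv
    · intro v hv
      have : v ≠ x := by rintro rfl; exact hv h.mem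
      rw [Function.update_of_ne this]
      exact h.eq_off v hv

variable [Finite V]

theorem IsHoleColoring.ncard_eq (hR : IsRigid H Δ W φ₀) {x : V} {φ : V → ℕ}
    (h : IsHoleColoring H Δ W φ₀ x φ) : (H.neighborSet x).ncard = Δ := by
  refine le_antisymm (hR.degree_le x) ?_
  have h1 := Set.ncard_image_le (f := φ) (Set.toFinite (H.neighborSet x))
  rw [h.image_eq hR, Set.ncard_coe_finset] at h1
  simpa using h1

theorem IsHoleColoring.injOn (hR : IsRigid H Δ W φ₀) {x : V} {φ : V → ℕ}
    (h : IsHoleColoring H Δ W φ₀ x φ) : Set.InjOn φ (H.neighborSet x) := by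
  refine Set.injOn_of_ncard_image_eq ?_ (Set.toFinite _)
  rw [h.image_eq hR, h.ncard_eq hR, Set.ncard_coe_finset]
  simp

-- Since `y` is the only neighbor of `x` with its color, `x` may take that color once `y` becomes
-- the hole.
open Classical in
theorem IsHoleColoring.move (hR : IsRigid H Δ W φ₀) {x y : V} {φ : V → ℕ}
    (h : IsHoleColoring H Δ W φ₀ x φ) (hxy : H.Adj x y) (hy : y ∈ W) :
    IsHoleColoring H Δ W φ₀ y (Function.update φ x (φ y)) where
  mem := hy
  mem_Icc v := by
    by_cases hv : v = x
    · subst hv; simpa using h.mem_Icc y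
    · simpa [Function.update_of_ne hv] using h.mem_Icc v
  ne_of_adj u v hu hv huv := by
    by_cases hux : u = x
    · subst hux
      rw [Function.update_self, Function.update_of_ne huv.ne']
      exact fun e => hv (h.injOn hR hxy huv e).symm
    · by_cases hvx : v = x
      · subst hvx
        rw [Function.update_self, Function.update_of_ne hux]
        exact fun e => hu (h.injOn hR huv.symm hxy e)
      · rw [Function.update_of_ne hux, Function.update_of_ne hvx]
        exact h.ne_of_adj u v hux hvx huv
  eq_off v hv := by
    have : v ≠ x := by rintro rfl; exact hv h.mem
    rw [Function.update_of_ne this]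
    exact h.eq_off v hv

/-- `p 0, …, p k` is a cycle of `H` in `W`, and `p 0` lies on no chord of it. -/
structure IsCycleAt (H : SimpleGraph V) (W : Set V) (p : ℕ → V) (k : ℕ) : Prop where
  two_le : 2 ≤ k
  mem : ∀ i ≤ k, p i ∈ W
  inj : ∀ i ≤ k, ∀ j ≤ k, p i = p j → i = j
  adj : ∀ i < k, H.Adj (p i) (p (i + 1))
  adj_last : H.Adj (p k) (p 0)
  chordless : ∀ i, 1 < i → i < k → ¬ H.Adj (p 0) (p i)

theorem IsHoleColoring.slide (hR : IsRigid H Δ W φ₀) {p : ℕ → V} {k : ℕ}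
    (hp : IsCycleAt H W p k) {φ : V → ℕ} (h : IsHoleColoring H Δ W φ₀ (p 0) φ) :
    ∀ j ≤ k, ∃ φ', IsHoleColoring H Δ W φ₀ (p j) φ' ∧ (∀ i < j, φ' (p i) = φ (p (i + 1))) ∧
      ∀ v, (∀ i < j, v ≠ p i) → φ' v = φ v := by
  classical
  intro j
  induction j with
  | zero => exact fun _ => ⟨φ, h, by simp, by simp⟩
  | succ j ih =>
    intro hj
    obtain ⟨φ', h', h1, h2⟩ := ih (by omega)
    have hval : φ' (p (j + 1)) = φ (p (j + 1)) :=
      h2 _ fun i hi e => by have := hp.inj _ hj _ (by omega) e; omega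
    refine ⟨_, h'.move hR (hp.adj j (by omega)) (hp.mem _ hj), ?_, ?_⟩
    · intro i hi
      by_cases hij : i = j
      · subst hij; rw [Function.update_self, hval]
      · have : p i ≠ p j := fun e => hij (hp.inj _ (by omega) _ (by omega) e)
        rw [Function.update_of_ne this, h1 i (by omega)]
    · intro v hv
      rw [Function.update_of_ne (hv j (by omega)), h2 v fun i hi => hv i (by omega)]

theorem IsHoleColoring.rotate (hR : IsRigid H Δ W φ₀) {p : ℕ → V} {k : ℕ}
    (hp : IsCycleAt H W p k) {φ : V → ℕ} (h : IsHoleColoring H Δ W φ₀ (p 0) φ) :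
    ∃ φ', IsHoleColoring H Δ W φ₀ (p 0) φ' ∧ (∀ i, 1 ≤ i → i < k → φ' (p i) = φ (p (i + 1))) ∧
      φ' (p k) = φ (p 1) ∧ ∀ v, (∀ i ≤ k, v ≠ p i) → φ' v = φ v := by
  classical
  have hk := hp.two_le
  obtain ⟨φ', h', h1, h2⟩ := h.slide hR hp k le_rfl
  refine ⟨_, h'.move hR hp.adj_last (hp.mem 0 (by omega)), ?_, ?_, ?_⟩
  · intro i hi hik
    have : p i ≠ p k := fun e => by have := hp.inj _ (by omega) _ (by omega) e; omega
    rw [Function.update_of_ne this, h1 i hik]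
  · rw [Function.update_self, h1 0 (by omega)]
  · intro v hv
    rw [Function.update_of_ne (hv k le_rfl), h2 v fun i hi => hv i (by omega)]

/-- A full turn of the hole changes only two colors around it: `p 1` gets the color of `p 2` and `p
k` that of `p 1`. All `Δ` colors must still occur, so the lost color `φ (p k)` has to be the new
color `φ (p 2)`. -/
theorem IsHoleColoring.cycle_eq (hR : IsRigid H Δ W φ₀) {p : ℕ → V} {k : ℕ}
    (hp : IsCycleAt H W p k) {φ : V → ℕ} (h : IsHoleColoring H Δ W φ₀ (p 0) φ) :
    φ (p 2) = φ (p k) := by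
  have hk := hp.two_le
  obtain rfl | hk2 := hk.eq_or_lt
  · rfl
  obtain ⟨φ', h', h1, h2, h3⟩ := h.rotate hR hp
  have hmem : φ (p k) ∈ φ' '' H.neighborSet (p 0) := by
    rw [h'.image_eq hR]; exact h.mem_Icc _
  have hadj1 : H.Adj (p 0) (p 1) := hp.adj 0 (by omega)
  obtain ⟨v, hv, hvk⟩ := hmem
  by_cases hex : ∃ i ≤ k, v = p i
  · obtain ⟨i, hi, rfl⟩ := hex
    have hi0 : i ≠ 0 := by rintro rfl; exact H.irrefl hv
    by_cases hi1 : i = 1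
    · subst hi1; rw [← hvk, h1 1 le_rfl (by omega)]
    by_cases hik : i = k
    · subst hik
      rw [h2] at hvk
      have := hp.inj _ (by omega) _ le_rfl (h.injOn hR hadj1 hp.adj_last.symm hvk)
      omega
    · exact absurd hv (hp.chordless i (by omega) (by omega))
  · push Not at hex
    rw [h3 v hex] at hvk
    exact absurd (h.injOn hR hv hp.adj_last.symm hvk) (hex k le_rfl)

/-- Each turn shifts the colors by one position, so the relation at one index follows from the
relation at the previous index for the rotated coloring. The start is `cycle_eq` after one turn. -/
theorem IsHoleColoring.cycle_alternates (hR : IsRigid H Δ W φ₀) {p : ℕ → V} {k : ℕ}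
    (hp : IsCycleAt H W p k) (j : ℕ) : ∀ {φ : V → ℕ}, IsHoleColoring H Δ W φ₀ (p 0) φ →
    1 ≤ j → j + 2 ≤ k → φ (p (j + 2)) = φ (p j) := by
  induction j with
  | zero => intro φ _ h; omega
  | succ j ih =>
    intro φ h _ hk
    obtain ⟨φ', h', h1, h2, -⟩ := h.rotate hR hp
    by_cases hj : j = 0
    · subst hj
      have := h'.cycle_eq hR hp
      rw [h1 2 (by omega) (by omega), h2] at this
      exact this
    · have := ih h' (by omega) (by omega)
      rw [h1 (j + 2) (by omega) (by omega), h1 j (by omega) (by omega)] at this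
      exact this

/-- By alternation `p 1` and the last node have the same color, although both are neighbors of the
hole. -/
theorem IsHoleColoring.even_cycle (hR : IsRigid H Δ W φ₀) {p : ℕ → V} {m : ℕ}
    (hp : IsCycleAt H W p (2 * m + 1)) {φ : V → ℕ} (h : IsHoleColoring H Δ W φ₀ (p 0) φ) :
    False := by
  have hk := hp.two_le
  have key : ∀ i, i ≤ m → φ (p (2 * i + 1)) = φ (p 1) := by
    intro i
    induction i with
    | zero => simp
    | succ i ih =>
      intro hi
      rw [← ih (by omega)]
      exact h.cycle_alternates hR hp (2 * i + 1) (by omega) (by omega)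
  have := hp.inj _ le_rfl _ (by omega)
    (h.injOn hR hp.adj_last.symm (hp.adj 0 (by omega)) (key m le_rfl))
  omega

/-- The subgraph of `H` on the nodes of `W` that are neither `x` nor neighbors of `x` other
than `y`. -/
def awayFrom (H : SimpleGraph V) (W : Set V) (x y : V) : SimpleGraph V where
  Adj a b := H.Adj a b ∧ (a ∈ W ∧ a ≠ x ∧ (H.Adj x a → a = y)) ∧
    (b ∈ W ∧ b ≠ x ∧ (H.Adj x b → b = y))
  symm := ⟨fun _ _ h => ⟨h.1.symm, h.2.2, h.2.1⟩⟩
  loopless := ⟨fun _ h => H.irrefl h.1⟩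

/-- A path from `z` to `y` in `awayFrom` closes up to the cycle `x, x₁, z, …, y`. It avoids `x₁` and
creates no chord at `x`, because `y` is the only neighbor of `x` that it may use; hence `cycle_eq`
applies. -/
theorem IsHoleColoring.eq_of_reachable (hR : IsRigid H Δ W φ₀) {x x₁ y z : V} {φ : V → ℕ}
    (h : IsHoleColoring H Δ W φ₀ x φ) (hx₁ : H.Adj x x₁) (hx₁W : x₁ ∈ W) (hy : H.Adj x y)
    (hyW : y ∈ W) (hne : x₁ ≠ y) (hz : H.Adj x₁ z) (hr : (awayFrom H W x y).Reachable z y) :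
    φ z = φ y := by
  classical
  obtain ⟨w, hw⟩ := hr.exists_isPath
  by_cases hlen : w.length = 0
  · rw [SimpleGraph.Walk.eq_of_length_eq_zero hlen]
  have hside : ∀ i ≤ w.length, w.getVert i ∈ W ∧ w.getVert i ≠ x ∧
      (H.Adj x (w.getVert i) → w.getVert i = y) := by
    intro i hi
    by_cases hi' : i < w.length
    · exact (w.adj_getVert_succ hi').2.1
    · have : i = w.length := by omega
      subst this
      rw [w.getVert_length]
      exact ⟨hyW, hy.ne', fun _ => rfl⟩
  have hinj := hw.getVert_injOn
  let p : ℕ → V := fun i => if i = 0 then x else if i = 1 then x₁ else w.getVert (i - 2)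
  have hp0 : p 0 = x := rfl
  have hp1 : p 1 = x₁ := rfl
  have hp2 : ∀ i, p (i + 2) = w.getVert i := fun i => by simp [p]
  have hcyc : IsCycleAt H W p (w.length + 2) := by
    refine ⟨by omega, ?_, ?_, ?_, ?_, ?_⟩
    · rintro (_ | _ | i) hi
      · exact h.mem
      · exact hx₁W
      · rw [hp2]; exact (hside i (by omega)).1
    · have hx1ne : ∀ i ≤ w.length, x₁ ≠ w.getVert i := by
        intro i hi e
        exact hne (e ▸ (hside i hi).2.2 (e ▸ hx₁))
      rintro (_ | _ | i) hi (_ | _ | j) hj e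
      · rfl
      · exact absurd e hx₁.ne
      · rw [hp2] at e; exact absurd e.symm (hside j (by omega)).2.1
      · exact absurd e hx₁.ne'
      · rfl
      · rw [hp2] at e; exact absurd e (hx1ne j (by omega))
      · rw [hp2] at e; exact absurd e (hside i (by omega)).2.1
      · rw [hp2] at e; exact absurd e.symm (hx1ne i (by omega))
      · rw [hp2, hp2] at e
        have := hinj (show i ≤ w.length by omega) (show j ≤ w.length by omega) e
        omega
    · rintro (_ | _ | i) hi
      · exact hx₁
      · rw [hp2, w.getVert_zero]; exact hz
      · rw [hp2, show i + 1 + 1 + 1 = (i + 1) + 2 from rfl, hp2]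
        exact (w.adj_getVert_succ (by omega)).1
    · rw [hp2, w.getVert_length]; exact hy.symm
    · rintro (_ | _ | i) hi hi' hadj
      · omega
      · omega
      · rw [hp2] at hadj
        have e := (hside i (by omega)).2.2 hadj
        have := hinj (show i ≤ w.length by omega) (show w.length ≤ w.length from le_rfl)
          (e.trans w.getVert_length.symm)
        omega
  have := IsHoleColoring.cycle_eq hR hcyc (φ := φ) h
  rw [hp2, hp2, w.getVert_length, w.getVert_zero] at this
  exact this

/-- Both `z` and `z'` have the color of `y`. Once the hole has moved to `x₁`, its neighbors are
colored injectively. -/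
theorem eq_of_reachable_of_reachable (hR : IsRigid H Δ W φ₀) {x x₁ y z z' : V} {φ : V → ℕ}
    (h : IsHoleColoring H Δ W φ₀ x φ) (hx₁ : H.Adj x x₁) (hx₁W : x₁ ∈ W) (hy : H.Adj x y)
    (hyW : y ∈ W) (hne : x₁ ≠ y) (hz : H.Adj x₁ z) (hzx : z ≠ x) (hz' : H.Adj x₁ z')
    (hzx' : z' ≠ x) (hr : (awayFrom H W x y).Reachable z y)
    (hr' : (awayFrom H W x y).Reachable z' y) : z = z' := by
  classical
  have e : φ z = φ z' := (h.eq_of_reachable hR hx₁ hx₁W hy hyW hne hz hr).trans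
    (h.eq_of_reachable hR hx₁ hx₁W hy hyW hne hz' hr').symm
  refine (h.move hR hx₁ hx₁W).injOn hR hz hz' ?_
  rwa [Function.update_of_ne hzx, Function.update_of_ne hzx']

end Hole

/-! ### Growth of the balls in which a hole cannot be filled -/

/-- `lev` behaves like the distance from `c`, at least up to distance `r`. -/
structure IsLayering {V : Type} (H : SimpleGraph V) (c : V) (r : ℕ) (lev : V → ℕ) : Prop where
  eq_zero_iff : ∀ v, lev v = 0 ↔ v = c
  le_succ : ∀ u v, H.Adj u v → lev v ≤ lev u + 1
  exists_parent : ∀ v, v ≠ c → lev v ≤ r → ∃ u, H.Adj v u ∧ lev u + 1 = lev v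

/-- Every node at distance at most `r` from `c` can be the hole, and no hole can be filled. -/
structure IsStuck {V : Type} (H : SimpleGraph V) (Δ : ℕ) (φ₀ : V → ℕ) (c : V) (r : ℕ)
    (lev : V → ℕ) : Prop where
  layering : IsLayering H c r lev
  rigid : IsRigid H Δ {v | lev v ≤ r} φ₀
  exists_hole : ∀ x, lev x ≤ r → ∃ φ, IsHoleColoring H Δ {v | lev v ≤ r} φ₀ x φ

section Stuck

variable {V : Type} {H : SimpleGraph V} {Δ : ℕ} {φ₀ : V → ℕ} {c : V} {r : ℕ}
  {lev : V → ℕ}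

theorem IsLayering.exists_parentFun (hL : IsLayering H c r lev) : ∃ par : V → V,
    ∀ u, lev u ≤ r → ∀ i ≤ lev u, lev (par^[i] u) + i = lev u ∧
      (i < lev u → H.Adj (par^[i] u) (par^[i + 1] u)) := by
  classical
  have : ∀ v, ∃ u, lev v ≤ r → v ≠ c → H.Adj v u ∧ lev u + 1 = lev v := by
    intro v
    by_cases hv : lev v ≤ r ∧ v ≠ c
    · obtain ⟨u, hu⟩ := hL.exists_parent v hv.2 hv.1
      exact ⟨u, fun _ _ => hu⟩
    · exact ⟨v, fun h1 h2 => absurd ⟨h1, h2⟩ hv⟩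
  choose par hpar using this
  refine ⟨par, fun u hu i hi => ?_⟩
  have key : ∀ i ≤ lev u, lev (par^[i] u) + i = lev u := by
    intro i
    induction i with
    | zero => simp
    | succ i ih =>
      intro hi
      have h1 := ih (by omega)
      have h2 : par^[i] u ≠ c := fun e => by
        have := (hL.eq_zero_iff _).2 e; omega
      have h3 := (hpar (par^[i] u) (by omega) h2).2
      rw [Function.iterate_succ_apply']
      omega
  refine ⟨key i hi, fun hi' => ?_⟩
  have h1 := key i hi
  have h2 : par^[i] u ≠ c := fun e => by
    have := (hL.eq_zero_iff _).2 e; omega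
  rw [Function.iterate_succ_apply']
  exact (hpar (par^[i] u) (by omega) h2).1

/-- The way down along parents stays below the level of `x`, and after its first node at least two
levels below, out of reach of the neighbors of `x`. -/
theorem awayFrom_reachable_root (hL : IsLayering H c r lev) {x y : V} (hx : lev x ≤ r) (k : ℕ) :
    ∀ z, lev z = k → k < lev x → (H.Adj x z → z = y) →
      (awayFrom H {v | lev v ≤ r} x y).Reachable z c := by
  induction k with
  | zero =>
    intro z hz _ _
    rw [(hL.eq_zero_iff z).1 hz]
  | succ k ih =>
    intro z hz hlt hzy
    have hzc : z ≠ c := fun e => by have := (hL.eq_zero_iff z).2 e; omega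
    obtain ⟨w, hzw, hw⟩ := hL.exists_parent z hzc (by omega)
    have hnw : ¬ H.Adj x w := fun h => by have := hL.le_succ _ _ h.symm; omega
    refine SimpleGraph.Reachable.trans (SimpleGraph.Adj.reachable ?_)
      (ih w (by omega) (by omega) fun h => absurd h hnw)
    refine ⟨hzw, ⟨show lev z ≤ r by omega, ?_, hzy⟩, show lev w ≤ r by omega, ?_,
      fun h => absurd h hnw⟩
    · rintro rfl; omega
    · rintro rfl; omega

variable [Finite V]

/-- Two parents start two chains towards the root, of equal length up to their first common node.
Together with `v` they form an even cycle, and `v` has no chord on it because all nodes other than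
its two parents are at least two levels below `v`. -/
theorem IsStuck.parent_unique (hS : IsStuck H Δ φ₀ c r lev) {v u₁ u₂ : V} (hv : lev v ≤ r)
    (h₁ : H.Adj v u₁) (hl₁ : lev u₁ + 1 = lev v) (h₂ : H.Adj v u₂) (hl₂ : lev u₂ + 1 = lev v) :
    u₁ = u₂ := by
  classical
  by_contra hne
  have hL := hS.layering
  obtain ⟨par, hpar⟩ := hL.exists_parentFun
  have p₁ := hpar u₁ (by omega)
  have p₂ := hpar u₂ (by omega)
  have hex : ∃ i, par^[i] u₁ = par^[i] u₂ := by
    refine ⟨lev u₁, ?_⟩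
    have e1 := (p₁ (lev u₁) le_rfl).1
    have e2 := (p₂ (lev u₁) (by omega)).1
    rw [(hL.eq_zero_iff (par^[lev u₁] u₁)).1 (by omega),
      (hL.eq_zero_iff (par^[lev u₁] u₂)).1 (by omega)]
  obtain ⟨m, hm, hmin⟩ : ∃ m, par^[m] u₁ = par^[m] u₂ ∧
      ∀ i < m, par^[i] u₁ ≠ par^[i] u₂ :=
    ⟨Nat.find hex, Nat.find_spec hex, fun i hi => Nat.find_min hex hi⟩
  have hm1 : 1 ≤ m := by
    rcases Nat.eq_zero_or_pos m with rfl | h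
    · exact absurd hm hne
    · exact h
  have hml : m ≤ lev u₁ := by
    by_contra hlt
    refine hmin (lev u₁) (by omega) ?_
    have e1 := (p₁ (lev u₁) le_rfl).1
    have e2 := (p₂ (lev u₁) (by omega)).1
    rw [(hL.eq_zero_iff (par^[lev u₁] u₁)).1 (by omega),
      (hL.eq_zero_iff (par^[lev u₁] u₂)).1 (by omega)]
  let p : ℕ → V := fun i => if i = 0 then v else if i ≤ m + 1 then par^[i - 1] u₁
    else par^[2 * m + 1 - i] u₂
  have q0 : p 0 = v := rfl
  have q1 : ∀ i ≤ m, p (i + 1) = par^[i] u₁ := fun i hi => by simp [p, hi]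
  have q2 : ∀ i, i ≤ m → p (2 * m + 1 - i) = par^[i] u₂ := by
    intro i hi
    by_cases him : i = m
    · subst him
      rw [show 2 * i + 1 - i = i + 1 by omega, q1 i le_rfl, hm]
    · simp only [p]
      rw [if_neg (by omega), if_neg (by omega)]
      congr 2
      omega
  have cases3 : ∀ i ≤ 2 * m + 1, i = 0 ∨ (∃ j ≤ m, i = j + 1) ∨
      ∃ j, j < m ∧ i = 2 * m + 1 - j := by
    intro i hi
    by_cases h0 : i = 0
    · exact Or.inl h0
    by_cases h1 : i ≤ m + 1
    · exact Or.inr (Or.inl ⟨i - 1, by omega, by omega⟩)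
    · exact Or.inr (Or.inr ⟨2 * m + 1 - i, by omega, by omega⟩)
  have l1 : ∀ j ≤ m, lev (par^[j] u₁) + j = lev u₁ := fun j hj => (p₁ j (by omega)).1
  have l2 : ∀ j ≤ m, lev (par^[j] u₂) + j = lev u₂ := fun j hj => (p₂ j (by omega)).1
  have hcyc : IsCycleAt H {v | lev v ≤ r} p (2 * m + 1) := by
    refine ⟨by omega, ?_, ?_, ?_, ?_, ?_⟩
    · intro i hi
      show lev (p i) ≤ r
      rcases cases3 i hi with rfl | ⟨j, hj, rfl⟩ | ⟨j, hj, rfl⟩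
      · exact hv
      · rw [q1 j hj]; have := l1 j hj; omega
      · rw [q2 j (by omega)]; have := l2 j (by omega); omega
    · have v1 : ∀ j ≤ m, v ≠ par^[j] u₁ := fun j hj e => by
        have := l1 j hj; rw [← e] at this; omega
      have v2 : ∀ j ≤ m, v ≠ par^[j] u₂ := fun j hj e => by
        have := l2 j hj; rw [← e] at this; omega
      have d : ∀ j ≤ m, ∀ j' < m, par^[j] u₁ ≠ par^[j'] u₂ := fun j hj j' hj' e => by
        have a1 := l1 j hj
        have a2 := l2 j' (by omega)
        rw [e] at a1
        have : j = j' := by omega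
        subst this
        exact hmin j hj' e
      intro i hi i' hi' e
      rcases cases3 i hi with rfl | ⟨j, hj, rfl⟩ | ⟨j, hj, rfl⟩ <;>
      rcases cases3 i' hi' with rfl | ⟨j', hj', rfl⟩ | ⟨j', hj', rfl⟩
      · rfl
      · rw [q1 j' hj'] at e; exact absurd e (v1 j' hj')
      · rw [q2 j' (by omega)] at e; exact absurd e (v2 j' (by omega))
      · rw [q1 j hj] at e; exact absurd e.symm (v1 j hj)
      · rw [q1 j hj, q1 j' hj'] at e
        have a1 := l1 j hj
        have a2 := l1 j' hj'
        rw [e] at a1; omega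
      · rw [q1 j hj, q2 j' (by omega)] at e; exact absurd e (d j hj j' hj')
      · rw [q2 j (by omega)] at e; exact absurd e.symm (v2 j (by omega))
      · rw [q1 j' hj', q2 j (by omega)] at e; exact absurd e.symm (d j' hj' j hj)
      · rw [q2 j (by omega), q2 j' (by omega)] at e
        have a1 := l2 j (by omega)
        have a2 := l2 j' (by omega)
        rw [e] at a1; omega
    · intro i hi
      by_cases h0 : i = 0
      · subst h0; rw [q1 0 (by omega)]; exact h₁
      by_cases h1 : i ≤ m
      · obtain ⟨j, rfl⟩ : ∃ j, i = j + 1 := ⟨i - 1, by omega⟩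
        rw [q1 j (by omega), q1 (j + 1) h1]
        exact (p₁ j (by omega)).2 (by omega)
      · obtain ⟨j, hj, rfl⟩ : ∃ j, j < m ∧ i = 2 * m + 1 - (j + 1) :=
          ⟨2 * m - i, by omega, by omega⟩
        rw [q2 (j + 1) (by omega), show 2 * m + 1 - (j + 1) + 1 = 2 * m + 1 - j by omega,
          q2 j (by omega)]
        exact ((p₂ j (by omega)).2 (by omega)).symm
    · have := q2 0 (by omega)
      rw [Nat.sub_zero] at this
      rw [this]; exact h₂.symm
    · intro i hi hi' hadj
      have hle := hL.le_succ _ _ hadj.symm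
      rw [q0] at hle
      rcases cases3 i hi'.le with rfl | ⟨j, hj, rfl⟩ | ⟨j, hj, rfl⟩
      · omega
      · rw [q1 j hj] at hle; have := l1 j hj; omega
      · rw [q2 j (by omega)] at hle; have := l2 j (by omega); omega
  obtain ⟨φ, hφ⟩ := hS.exists_hole v hv
  exact IsHoleColoring.even_cycle hS.rigid hcyc hφ

/-- If `x₁` and `y` are neighbors of `x`, then at most one neighbor of `x₁` other than `x` is connected
to `y` away from `x`. -/
theorem IsStuck.theta (hS : IsStuck H Δ φ₀ c r lev) {x x₁ y z z' : V} (hx : lev x ≤ r)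
    (hx₁ : H.Adj x x₁) (hx₁W : lev x₁ ≤ r) (hy : H.Adj x y)
    (hyW : lev y ≤ r) (hne : x₁ ≠ y) (hz : H.Adj x₁ z) (hzx : z ≠ x) (hz' : H.Adj x₁ z')
    (hzx' : z' ≠ x) (hr : (awayFrom H {v | lev v ≤ r} x y).Reachable z y)
    (hr' : (awayFrom H {v | lev v ≤ r} x y).Reachable z' y) : z = z' := by
  obtain ⟨φ, hφ⟩ := hS.exists_hole x hx
  exact eq_of_reachable_of_reachable hS.rigid hφ hx₁ hx₁W hy hyW hne hz hzx hz' hzx' hr hr'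

/-- With `p`, `v`, `u` in a triangle, a missing edge at `w` would give a second connection: if `w`
is not adjacent to `u`, then `p` and `w` are two continuations from `v` to `p` away from `u`; if `w`
is not adjacent to `p`, then `v` and `w` are two continuations from `u` to `v` away from `p`. Both
contradict `theta`. -/
theorem IsStuck.adj_of_sibling (hS : IsStuck H Δ φ₀ c r lev) {v u w p : V} (hv : lev v ≤ r)
    (hp : lev p + 1 = lev v) (hvp : H.Adj v p) (hup : H.Adj u p) (hvu : H.Adj v u)
    (hu : lev u = lev v) (hvw : H.Adj v w) (hw : lev w = lev v) (huw : u ≠ w) :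
    H.Adj w p ∧ H.Adj w u := by
  have hL := hS.layering
  have hwu : H.Adj w u := by
    by_contra hwu
    have hwU : w ∈ {v | lev v ≤ r} ∧ w ≠ u ∧ (H.Adj u w → w = p) :=
      ⟨show lev w ≤ r by omega, huw.symm, fun h => absurd h.symm hwu⟩
    have hpU : p ∈ {v | lev v ≤ r} ∧ p ≠ u ∧ (H.Adj u p → p = p) :=
      ⟨show lev p ≤ r by omega, hup.ne', fun _ => rfl⟩
    have hr : (awayFrom H {v | lev v ≤ r} u p).Reachable w p := by
      by_cases hwp : H.Adj w p
      · exact SimpleGraph.Adj.reachable ⟨hwp, hwU, hpU⟩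
      · have hwc : w ≠ c := fun e => by have := (hL.eq_zero_iff w).2 e; omega
        obtain ⟨p', hwp', hp'⟩ := hL.exists_parent w hwc (by omega)
        have hup' : ¬ H.Adj u p' := fun h => by
          have := hS.parent_unique (by omega) hup (by omega) h (by omega)
          subst this
          exact hwp hwp'
        have e1 : (awayFrom H {v | lev v ≤ r} u p).Reachable w p' :=
          SimpleGraph.Adj.reachable ⟨hwp', hwU, show lev p' ≤ r by omega,
            fun e => by subst e; omega, fun h => absurd h hup'⟩
        exact (e1.trans (awayFrom_reachable_root hL (by omega) _ p' rfl (by omega)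
          fun h => absurd h hup')).trans (awayFrom_reachable_root hL (by omega) _ p rfl (by omega)
            fun _ => rfl).symm
    have := hS.theta (x := u) (x₁ := v) (y := p) (z := p) (z' := w) (by omega) hvu.symm hv hup
      (by omega) hvp.ne hvp hup.ne' hvw huw.symm (SimpleGraph.Reachable.refl _) hr
    subst this
    omega
  refine ⟨?_, hwu⟩
  by_contra hwp
  have hr : (awayFrom H {v | lev v ≤ r} p v).Reachable w v :=
    SimpleGraph.Adj.reachable ⟨hvw.symm, ⟨show lev w ≤ r by omega, fun e => by subst e; omega,
      fun h => absurd h.symm hwp⟩, hv, hvp.ne, fun _ => rfl⟩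
  have := hS.theta (x := p) (x₁ := u) (y := v) (z := v) (z' := w) (by omega) hup.symm (by omega)
    hvp.symm hv hvu.ne' hvu.symm hvp.ne hwu.symm (fun e => by subst e; omega)
    (SimpleGraph.Reachable.refl _) hr
  exact hvw.ne this

/-- Such siblings reach the parent `g` of `p` through their own parents and the root, away from `p`.
By `theta` with the hole at `p`, only one neighbor of `v` can do this. -/
theorem IsStuck.not_adj_two (hS : IsStuck H Δ φ₀ c r lev) {v u w p : V} (hv : lev v ≤ r)
    (hp : lev p + 1 = lev v) (hvp : H.Adj v p) (hvu : H.Adj v u) (hu : lev u = lev v)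
    (hvw : H.Adj v w) (hw : lev w = lev v) (hup : ¬ H.Adj u p) (hwp : ¬ H.Adj w p) : u = w := by
  have hL := hS.layering
  have hpc : p ≠ c := by
    rintro rfl
    have h0 := (hL.eq_zero_iff p).2 rfl
    have huc : u ≠ p := fun e => by subst e; omega
    obtain ⟨p', hup', hp'⟩ := hL.exists_parent u huc (by omega)
    rw [(hL.eq_zero_iff p').1 (by omega)] at hup'
    exact hup hup'
  obtain ⟨g, hpg, hg⟩ := hL.exists_parent p hpc (by omega)
  have key : ∀ u, H.Adj v u → lev u = lev v → ¬ H.Adj u p →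
      (awayFrom H {v | lev v ≤ r} p g).Reachable u g := by
    intro u hvu hu hup
    have huc : u ≠ c := fun e => by have := (hL.eq_zero_iff u).2 e; omega
    obtain ⟨p', hup', hp'⟩ := hL.exists_parent u huc (by omega)
    have hup0 : u ≠ p := fun e => by subst e; omega
    have hp'p : p' ≠ p := fun e => by subst e; exact hup hup'
    -- An edge between `p` and `p'` would give the cycle `p, v, u, p'`, in which `u` and `p'` get
    -- the same color although they are adjacent.
    have hpp' : ¬ H.Adj p p' := by
      intro hpp'
      obtain ⟨φ, hφ⟩ := hS.exists_hole p (by omega)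
      have hr : (awayFrom H {v | lev v ≤ r} p p').Reachable u p' :=
        SimpleGraph.Adj.reachable ⟨hup', ⟨show lev u ≤ r by omega, hup0,
          fun h => absurd h.symm hup⟩, show lev p' ≤ r by omega, hp'p, fun _ => rfl⟩
      have := hφ.eq_of_reachable hS.rigid hvp.symm hv hpp' (show lev p' ≤ r by omega)
        (fun e => by subst e; omega) hvu hr
      exact hφ.ne_of_adj u p' hup0 hp'p hup' this
    have hp'c : p' ≠ c := fun e => by
      have := (hL.eq_zero_iff p').2 e
      omega
    obtain ⟨g', hpg', hg'⟩ := hL.exists_parent p' hp'c (by omega)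
    have hgg : H.Adj p g' → g' = g := fun h =>
      hS.parent_unique (by omega) h (by omega) hpg (by omega)
    have e1 : (awayFrom H {v | lev v ≤ r} p g).Reachable u p' :=
      SimpleGraph.Adj.reachable ⟨hup', ⟨show lev u ≤ r by omega, hup0,
        fun h => absurd h.symm hup⟩, show lev p' ≤ r by omega, hp'p, fun h => absurd h hpp'⟩
    have e2 : (awayFrom H {v | lev v ≤ r} p g).Reachable p' g' :=
      SimpleGraph.Adj.reachable ⟨hpg', ⟨show lev p' ≤ r by omega, hp'p, fun h => absurd h hpp'⟩,
        show lev g' ≤ r by omega, fun e => by subst e; omega, hgg⟩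
    exact ((e1.trans e2).trans (awayFrom_reachable_root hL (by omega) _ g' rfl (by omega)
      hgg)).trans (awayFrom_reachable_root hL (by omega) _ g rfl (by omega) fun _ => rfl).symm
  exact hS.theta (x := p) (x₁ := v) (y := g) (by omega) hvp.symm hv hpg (by omega)
    (fun e => by subst e; omega) hvu (fun e => by subst e; omega) hvw (fun e => by subst e; omega)
    (key u hvu hu hup) (key w hvw hw hwp)

/-- Otherwise both the parent of `p` and the sibling `w` of `p` lead from `p` through the root to
`u`, away from `v`, which `theta` forbids. -/
theorem IsStuck.parent_no_sibling (hS : IsStuck H Δ φ₀ c r lev) {v u p w : V} (hv : lev v ≤ r)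
    (hp : lev p + 1 = lev v) (hvp : H.Adj v p) (hvu : H.Adj v u) (hu : lev u = lev v)
    (hup : ¬ H.Adj u p) (hpw : H.Adj p w) : lev w ≠ lev p := by
  intro hw
  have hL := hS.layering
  have hpc : p ≠ c := fun e => by
    have := (hL.eq_zero_iff p).2 e
    exact hpw.ne (e.trans ((hL.eq_zero_iff w).1 (by omega)).symm)
  obtain ⟨g, hpg, hg⟩ := hL.exists_parent p hpc (by omega)
  have huc : u ≠ c := fun e => by have := (hL.eq_zero_iff u).2 e; omega
  obtain ⟨p', hup', hp'⟩ := hL.exists_parent u huc (by omega)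
  have hp'p : p' ≠ p := fun e => by subst e; exact hup hup'
  have hvp' : ¬ H.Adj v p' := fun h =>
    hp'p (hS.parent_unique hv h (by omega) hvp (by omega))
  have hvw : ¬ H.Adj v w := fun h =>
    hpw.ne (hS.parent_unique hv hvp (by omega) h (by omega))
  have hvg : ¬ H.Adj v g := fun h => by have := hL.le_succ _ _ h.symm; omega
  have e1 : (awayFrom H {v | lev v ≤ r} v u).Reachable p' u :=
    SimpleGraph.Adj.reachable ⟨hup'.symm, ⟨show lev p' ≤ r by omega, fun e => by subst e; omega,
      fun h => absurd h hvp'⟩, show lev u ≤ r by omega, hvu.ne', fun _ => rfl⟩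
  have e2 := (awayFrom_reachable_root hL (y := u) hv _ p' rfl (by omega)
    fun h => absurd h hvp').symm.trans e1
  have := hS.theta (x := v) (x₁ := p) (y := u) hv hvp (by omega) hvu (by omega)
    (fun e => by subst e; omega) hpg (fun e => by subst e; omega) hpw (fun e => by subst e; omega)
    ((awayFrom_reachable_root hL (y := u) hv _ g rfl (by omega) fun h => absurd h hvg).trans e2)
    ((awayFrom_reachable_root hL (y := u) hv _ w rfl (by omega) fun h => absurd h hvw).trans e2)
  subst this
  omega

end Stuck

section Growth

open Classical

variable {V : Type} [Fintype V] {H : SimpleGraph V} {Δ : ℕ} {φ₀ : V → ℕ} {c : V} {r : ℕ}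
  {lev : V → ℕ}

/-- The neighbors of `v` one level farther from the root. -/
noncomputable def childSet (H : SimpleGraph V) (lev : V → ℕ) (v : V) : Finset V :=
  Finset.univ.filter fun w => H.Adj v w ∧ lev w = lev v + 1

/-- The neighbors of `v` on its own level. -/
noncomputable def siblingSet (H : SimpleGraph V) (lev : V → ℕ) (v : V) : Finset V :=
  Finset.univ.filter fun w => H.Adj v w ∧ lev w = lev v

theorem mem_childSet {v w : V} : w ∈ childSet H lev v ↔ H.Adj v w ∧ lev w = lev v + 1 := by
  simp [childSet]

theorem mem_siblingSet {v w : V} : w ∈ siblingSet H lev v ↔ H.Adj v w ∧ lev w = lev v := by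
  simp [siblingSet]

theorem IsStuck.degree_bound (hS : IsStuck H Δ φ₀ c r lev) {v : V} (hv : lev v ≤ r) :
    Δ ≤ 1 + (siblingSet H lev v).card + (childSet H lev v).card := by
  obtain ⟨φ, hφ⟩ := hS.exists_hole v hv
  have hL := hS.layering
  rw [← hφ.ncard_eq hS.rigid]
  obtain ⟨p, hp⟩ : ∃ p, ∀ u, H.Adj v u → lev u + 1 = lev v → u = p := by
    by_cases hvc : v = c
    · refine ⟨v, fun u _ h => ?_⟩
      have := (hL.eq_zero_iff v).2 hvc
      omega
    · obtain ⟨p, hvp, hp⟩ := hL.exists_parent v hvc hv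
      exact ⟨p, fun u hu h => hS.parent_unique hv hu h hvp hp⟩
  have hsub : H.neighborSet v ⊆ ↑({p} ∪ siblingSet H lev v ∪ childSet H lev v : Finset V) := by
    intro u hu
    have h1 := hL.le_succ _ _ hu
    have h2 := hL.le_succ _ _ (SimpleGraph.Adj.symm hu)
    simp only [Finset.coe_union, Set.mem_union, Finset.mem_coe, mem_childSet, mem_siblingSet,
      Finset.mem_singleton]
    rcases lt_trichotomy (lev u) (lev v) with h | h | h
    · exact Or.inl (Or.inl (hp u hu (by omega)))
    · exact Or.inl (Or.inr ⟨hu, h⟩)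
    · exact Or.inr ⟨hu, by omega⟩
  refine (Set.ncard_le_ncard hsub (Set.toFinite _)).trans ?_
  rw [Set.ncard_coe_finset]
  refine (Finset.card_union_le _ _).trans ?_
  have := Finset.card_union_le {p} (siblingSet H lev v)
  rw [Finset.card_singleton] at this
  omega

theorem IsStuck.clique_of_sibling (hS : IsStuck H Δ φ₀ c r lev) {v u p : V} (hv : lev v ≤ r)
    (hp : lev p + 1 = lev v) (hvp : H.Adj v p) (hu : u ∈ siblingSet H lev v) (hup : H.Adj u p) :
    (∀ w ∈ siblingSet H lev v, H.Adj w p) ∧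
      ∀ w ∈ siblingSet H lev v, ∀ w' ∈ siblingSet H lev v, w ≠ w' → H.Adj w w' := by
  rw [mem_siblingSet] at hu
  have h1 : ∀ w ∈ siblingSet H lev v, H.Adj w p := by
    intro w hw
    rw [mem_siblingSet] at hw
    by_cases e : u = w
    · exact e ▸ hup
    · exact (hS.adj_of_sibling hv hp hvp hup hu.1 hu.2 hw.1 hw.2 e).1
  refine ⟨h1, fun w hw w' hw' e => ?_⟩
  have hwp := h1 w' hw'
  rw [mem_siblingSet] at hw hw'
  exact (hS.adj_of_sibling hv hp hvp hwp hw'.1 hw'.2 hw.1 hw.2 e.symm).2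

/-- Siblings that share the parent form a clique with `v` and the parent, so the clique hypothesis
bounds their number; otherwise there is at most one sibling and `3 ≤ Δ` suffices. Combined with
`degree_bound`, every node has a child. -/
theorem IsStuck.card_siblingSet (hS : IsStuck H Δ φ₀ c r lev) (hΔ : 3 ≤ Δ)
    (hfree : H.CliqueFree (Δ + 1)) {v : V} (hv : lev v ≤ r) :
    (siblingSet H lev v).card + 2 ≤ Δ := by
  have hL := hS.layering
  by_cases hvc : v = c
  · have : siblingSet H lev v = ∅ := by
      ext w
      simp only [mem_siblingSet, Finset.notMem_empty, iff_false, not_and]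
      intro hw e
      have h0 := (hL.eq_zero_iff v).2 hvc
      exact hw.ne (hvc.trans ((hL.eq_zero_iff w).1 (by omega)).symm)
    rw [this, Finset.card_empty]
    omega
  obtain ⟨p, hvp, hp⟩ := hL.exists_parent v hvc hv
  by_cases hA : ∃ u ∈ siblingSet H lev v, H.Adj u p
  · obtain ⟨u, hu, hup⟩ := hA
    obtain ⟨h1, h2⟩ := hS.clique_of_sibling hv hp hvp hu hup
    have hvS : v ∉ siblingSet H lev v := fun h => H.irrefl (mem_siblingSet.1 h).1
    have hpS : p ∉ insert v (siblingSet H lev v) := by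
      rw [Finset.mem_insert, mem_siblingSet]
      rintro (e | e)
      · exact hvp.ne e.symm
      · omega
    by_contra hlt
    refine (hfree.mono (show Δ + 1 ≤ (siblingSet H lev v).card + 1 + 1 by omega))
      (insert p (insert v (siblingSet H lev v))) ⟨?_, ?_⟩
    · rw [Finset.coe_insert, Finset.coe_insert]
      refine SimpleGraph.IsClique.insert (SimpleGraph.IsClique.insert ?_ ?_) ?_
      · exact fun a ha b hb e => h2 a ha b hb e
      · exact fun b hb _ => (mem_siblingSet.1 hb).1
      · rintro b (rfl | hb) _
        · exact hvp.symm
        · exact (h1 b hb).symm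
    · rw [Finset.card_insert_of_notMem hpS, Finset.card_insert_of_notMem hvS]
  · push Not at hA
    have : (siblingSet H lev v).card ≤ 1 := by
      refine Finset.card_le_one.2 fun a ha b hb => ?_
      have ha' := hA a ha
      have hb' := hA b hb
      rw [mem_siblingSet] at ha hb
      exact hS.not_adj_two hv hp hvp ha.1 ha.2 hb.1 hb.2 ha' hb'
    omega

/-- Three cases. Some children of `p` form a clique of size `s` as siblings, and each has at least
`Δ - s` children. Or some child has no sibling and hence `Δ - 1` children of its own. Or some child
has a sibling outside the family, so that `p` has no sibling and therefore `Δ - 1` children, each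
with at least one child. -/
theorem IsStuck.card_grandchildren (hS : IsStuck H Δ φ₀ c r lev) (hΔ : 3 ≤ Δ)
    (hfree : H.CliqueFree (Δ + 1)) {p : V} (hp : lev p + 2 ≤ r) :
    Δ - 1 ≤ ∑ v ∈ childSet H lev p, (childSet H lev v).card := by
  have hch : ∀ v, lev v ≤ r → 1 ≤ (childSet H lev v).card := fun v hv => by
    have := hS.degree_bound hv
    have := hS.card_siblingSet hΔ hfree hv
    omega
  by_cases hA : ∃ v ∈ childSet H lev p, ∃ u ∈ siblingSet H lev v, H.Adj u p
  · obtain ⟨v, hv, u, hu, hup⟩ := hA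
    rw [mem_childSet] at hv
    obtain ⟨h1, h2⟩ := hS.clique_of_sibling (by omega) hv.2.symm hv.1.symm hu hup
    set S := insert v (siblingSet H lev v) with hSdef
    have hvS : v ∉ siblingSet H lev v := fun h => H.irrefl (mem_siblingSet.1 h).1
    have hcard : S.card = (siblingSet H lev v).card + 1 := Finset.card_insert_of_notMem hvS
    have hle := hS.card_siblingSet hΔ hfree (v := v) (by omega)
    have hlev : ∀ w ∈ S, lev w = lev v := by
      intro w hw
      rcases Finset.mem_insert.1 hw with rfl | hw
      · rfl
      · exact (mem_siblingSet.1 hw).2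
    have hadj : ∀ w ∈ S, H.Adj w p := by
      intro w hw
      rcases Finset.mem_insert.1 hw with rfl | hw
      · exact hv.1.symm
      · exact h1 w hw
    have hcl : ∀ w ∈ S, ∀ w' ∈ S, w ≠ w' → H.Adj w w' := by
      intro w hw w' hw' e
      rcases Finset.mem_insert.1 hw with rfl | hw <;>
      rcases Finset.mem_insert.1 hw' with rfl | hw'
      · exact absurd rfl e
      · exact (mem_siblingSet.1 hw').1
      · exact (mem_siblingSet.1 hw).1.symm
      · exact h2 w hw w' hw' e
    have hsub : S ⊆ childSet H lev p := fun w hw =>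
      mem_childSet.2 ⟨(hadj w hw).symm, (hlev w hw).trans hv.2⟩
    have hsib : ∀ w ∈ S, siblingSet H lev w ⊆ S.erase w := by
      intro w hw x hx
      have hx' := mem_siblingSet.1 hx
      refine Finset.mem_erase.2 ⟨hx'.1.ne', ?_⟩
      by_cases hwv : w = v
      · subst hwv; exact Finset.mem_insert_of_mem hx
      by_cases hxv : v = x
      · subst hxv; exact Finset.mem_insert_self _ _
      refine Finset.mem_insert_of_mem (mem_siblingSet.2 ⟨?_, by rw [hx'.2, hlev w hw]⟩)
      have hwv' : H.Adj w v := hcl w hw v (Finset.mem_insert_self _ _) hwv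
      exact (hS.adj_of_sibling (v := w) (u := v) (w := x) (p := p)
        (by rw [hlev w hw]; omega) (by rw [hlev w hw]; omega) (hadj w hw) hv.1.symm hwv'
        (hlev w hw).symm hx'.1 hx'.2 hxv).2.symm
    have hbig : ∀ w ∈ S, Δ - S.card ≤ (childSet H lev w).card := by
      intro w hw
      have e1 := hS.degree_bound (v := w) (by rw [hlev w hw]; omega)
      have e2 := Finset.card_le_card (hsib w hw)
      rw [Finset.card_erase_of_mem hw] at e2
      omega
    -- For `1 ≤ s ≤ Δ - 1` the product `s * (Δ - s)` is smallest at the ends of the range.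
    calc Δ - 1 ≤ S.card * (Δ - S.card) := by
          obtain ⟨a, ha⟩ : ∃ a, S.card = a + 1 := ⟨_, hcard⟩
          obtain ⟨b, hb⟩ : ∃ b, Δ = a + b + 2 := ⟨Δ - a - 2, by omega⟩
          rw [ha, hb, show a + b + 2 - (a + 1) = b + 1 by omega]
          have : (a + 1) * (b + 1) = a * b + a + b + 1 := by ring
          omega
      _ = ∑ _w ∈ S, (Δ - S.card) := by rw [Finset.sum_const, smul_eq_mul]
      _ ≤ ∑ w ∈ S, (childSet H lev w).card := Finset.sum_le_sum hbig
      _ ≤ _ := Finset.sum_le_sum_of_subset hsub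
  push Not at hA
  by_cases hE : ∃ v ∈ childSet H lev p, siblingSet H lev v = ∅
  · obtain ⟨v, hv, he⟩ := hE
    have h1 := hS.degree_bound (v := v) (by have := (mem_childSet.1 hv).2; omega)
    rw [he, Finset.card_empty] at h1
    have h2 := Finset.single_le_sum (f := fun v => (childSet H lev v).card)
      (fun _ _ => Nat.zero_le _) hv
    omega
  · push Not at hE
    obtain ⟨v, hv⟩ := Finset.card_pos.1 (hch p (by omega))
    obtain ⟨u, hu⟩ := hE v hv
    have hup := hA v hv u hu
    have hv' := mem_childSet.1 hv
    have hu' := mem_siblingSet.1 hu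
    have he : siblingSet H lev p = ∅ := by
      ext w
      simp only [mem_siblingSet, Finset.notMem_empty, iff_false, not_and]
      exact fun hw => hS.parent_no_sibling (by omega) hv'.2.symm hv'.1.symm hu'.1 hu'.2 hup hw
    have h1 := hS.degree_bound (v := p) (by omega)
    rw [he, Finset.card_empty] at h1
    calc Δ - 1 ≤ (childSet H lev p).card := by omega
      _ = ∑ _v ∈ childSet H lev p, 1 := by simp
      _ ≤ _ := Finset.sum_le_sum fun w hw => hch w (by have := (mem_childSet.1 hw).2; omega)

theorem IsStuck.childSet_disjoint (hS : IsStuck H Δ φ₀ c r lev) {u v : V} (huv : lev u = lev v)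
    (hv : lev v + 1 ≤ r) (hne : u ≠ v) : Disjoint (childSet H lev u) (childSet H lev v) := by
  rw [Finset.disjoint_left]
  intro w hu hv'
  rw [mem_childSet] at hu hv'
  exact hne (hS.parent_unique (by omega) hu.1.symm hu.2.symm hv'.1.symm hv'.2.symm)

/-- Parents are unique, so the sets of grandchildren of different nodes of a level are disjoint and
their sizes add up. -/
theorem IsStuck.card_level (hS : IsStuck H Δ φ₀ c r lev) (hΔ : 3 ≤ Δ)
    (hfree : H.CliqueFree (Δ + 1)) (j : ℕ) (hj : 2 * j ≤ r) :
    (Δ - 1) ^ j ≤ (Finset.univ.filter fun v => lev v = 2 * j).card := by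
  induction j with
  | zero =>
    rw [pow_zero, Nat.one_le_iff_ne_zero, ← Nat.pos_iff_ne_zero, Finset.card_pos]
    exact ⟨c, by simpa using (hS.layering.eq_zero_iff c).2 rfl⟩
  | succ j ih =>
    set P := Finset.univ.filter fun v => lev v = 2 * j with hP
    have hPm : ∀ p ∈ P, lev p = 2 * j := fun p hp => (Finset.mem_filter.1 hp).2
    have hd : (P : Set V).PairwiseDisjoint (childSet H lev) := fun a ha b hb e =>
      hS.childSet_disjoint ((hPm a ha).trans (hPm b hb).symm) (by rw [hPm b hb]; omega) e
    have hQm : ∀ v ∈ P.biUnion (childSet H lev), lev v = 2 * j + 1 := by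
      intro v hv
      obtain ⟨p, hp, hv⟩ := Finset.mem_biUnion.1 hv
      rw [(mem_childSet.1 hv).2, hPm p hp]
    have hd' : ((P.biUnion (childSet H lev) : Finset V) : Set V).PairwiseDisjoint
        (childSet H lev) := fun a ha b hb e =>
      hS.childSet_disjoint ((hQm a ha).trans (hQm b hb).symm) (by rw [hQm b hb]; omega) e
    calc (Δ - 1) ^ (j + 1) = (Δ - 1) ^ j * (Δ - 1) := pow_succ _ _
      _ ≤ P.card * (Δ - 1) := Nat.mul_le_mul_right _ (ih (by omega))
      _ = ∑ _p ∈ P, (Δ - 1) := by rw [Finset.sum_const, smul_eq_mul]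
      _ ≤ ∑ p ∈ P, ∑ v ∈ childSet H lev p, (childSet H lev v).card :=
          Finset.sum_le_sum fun p hp =>
            hS.card_grandchildren hΔ hfree (by rw [hPm p hp]; omega)
      _ = ∑ v ∈ P.biUnion (childSet H lev), (childSet H lev v).card :=
          (Finset.sum_biUnion hd).symm
      _ = ((P.biUnion (childSet H lev)).biUnion (childSet H lev)).card :=
          (Finset.card_biUnion hd').symm
      _ ≤ _ := by
          refine Finset.card_le_card fun w hw => ?_
          obtain ⟨v, hv, hw⟩ := Finset.mem_biUnion.1 hw
          rw [Finset.mem_filter]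
          refine ⟨Finset.mem_univ _, ?_⟩
          rw [(mem_childSet.1 hw).2, hQm v hv]
          omega

end Growth

/-! ### Balls and recoloring -/

/-- The nodes that are reached from `v` by a walk of length at most `s`. -/
def nodeBall {V : Type} (G : SimpleGraph V) (s : ℕ) (v : V) : Set V :=
  {u | ∃ p : G.Walk v u, p.length ≤ s}

section Ball

variable {V : Type} {G : SimpleGraph V} {s t : ℕ} {u v w : V}

theorem self_mem_nodeBall (s : ℕ) (v : V) : v ∈ nodeBall G s v :=
  ⟨SimpleGraph.Walk.nil, Nat.zero_le _⟩

theorem nodeBall_comm : u ∈ nodeBall G s v ↔ v ∈ nodeBall G s u := by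
  constructor <;> rintro ⟨p, hp⟩ <;> exact ⟨p.reverse, by simpa using hp⟩

theorem nodeBall_mono (h : s ≤ t) : nodeBall G s v ⊆ nodeBall G t v :=
  fun _ ⟨p, hp⟩ => ⟨p, hp.trans h⟩

theorem nodeBall_trans (h₁ : u ∈ nodeBall G s v) (h₂ : w ∈ nodeBall G t u) :
    w ∈ nodeBall G (s + t) v := by
  obtain ⟨p, hp⟩ := h₁
  obtain ⟨q, hq⟩ := h₂
  exact ⟨p.append q, by rw [SimpleGraph.Walk.length_append]; omega⟩

theorem mem_nodeBall_of_adj (h : G.Adj v u) : u ∈ nodeBall G 1 v :=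
  ⟨h.toWalk, by simp⟩

theorem nodeBall_zero : nodeBall G 0 v = {v} := by
  ext u
  constructor
  · rintro ⟨p, hp⟩
    exact (SimpleGraph.Walk.eq_of_length_eq_zero (Nat.le_zero.1 hp)).symm
  · rintro rfl
    exact self_mem_nodeBall 0 u

theorem mem_nodeBall_succ : u ∈ nodeBall G (s + 1) v ↔
    u ∈ nodeBall G s v ∨ ∃ w, G.Adj v w ∧ u ∈ nodeBall G s w := by
  constructor
  · rintro ⟨p, hp⟩
    cases p with
    | nil => exact Or.inl (self_mem_nodeBall _ _)
    | cons h p =>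
      rw [SimpleGraph.Walk.length_cons] at hp
      exact Or.inr ⟨_, h, p, by omega⟩
  · rintro (h | ⟨w, hw, h⟩)
    · exact nodeBall_mono (Nat.le_succ s) h
    · rw [Nat.add_comm]
      exact nodeBall_trans (mem_nodeBall_of_adj hw) h

theorem nodeBall_mono_graph {G' : SimpleGraph V} (h : G' ≤ G) :
    nodeBall G' s v ⊆ nodeBall G s v := by
  rintro u ⟨p, hp⟩
  exact ⟨p.mapLe h, by simpa using hp⟩

end Ball

theorem exists_layering {V : Type} (H : SimpleGraph V) (c : V) (r : ℕ) :
    ∃ lev : V → ℕ, IsLayering H c r lev ∧ {v | lev v ≤ r} = nodeBall H r c := by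
  classical
  refine ⟨fun v => if H.Reachable c v then H.dist c v else r + 1, ⟨?_, ?_, ?_⟩, ?_⟩
  · intro v
    by_cases h : H.Reachable c v
    · simp only [if_pos h, h.dist_eq_zero_iff]
      exact eq_comm
    · simp only [if_neg h, Nat.add_eq_zero_iff, one_ne_zero, and_false, false_iff]
      rintro rfl
      exact h (SimpleGraph.Reachable.refl _)
  · intro u v huv
    by_cases h : H.Reachable c u
    · have h' : H.Reachable c v := h.trans huv.reachable
      simp only [if_pos h, if_pos h']
      obtain ⟨p, hp⟩ := h.exists_walk_length_eq_dist
      have := SimpleGraph.dist_le (p.concat huv)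
      rw [SimpleGraph.Walk.length_concat] at this
      omega
    · have h' : ¬ H.Reachable c v := fun h' => h (h'.trans huv.symm.reachable)
      simp only [if_neg h, if_neg h']
      omega
  · intro v hvc hv
    have h : H.Reachable c v := by
      by_contra h
      simp only [if_neg h] at hv
      omega
    obtain ⟨p, hp⟩ := h.symm.exists_walk_length_eq_dist
    cases p with
    | nil => exact absurd rfl hvc
    | @cons _ u _ huv p =>
      rw [SimpleGraph.Walk.length_cons] at hp
      have h' : H.Reachable c u := h.trans huv.reachable
      refine ⟨u, huv, ?_⟩
      simp only [if_pos h, if_pos h']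
      have h1 := SimpleGraph.dist_le p.reverse
      rw [SimpleGraph.Walk.length_reverse] at h1
      obtain ⟨w, hw⟩ := h'.exists_walk_length_eq_dist
      have h2 := SimpleGraph.dist_le (w.concat huv.symm)
      rw [SimpleGraph.Walk.length_concat] at h2
      rw [SimpleGraph.dist_comm] at hp
      omega
  · ext v
    constructor
    · intro hv
      have h : H.Reachable c v := by
        by_contra h
        simp only [Set.mem_ofPred_eq, if_neg h] at hv
        omega
      simp only [Set.mem_ofPred_eq, if_pos h] at hv
      obtain ⟨p, hp⟩ := h.exists_walk_length_eq_dist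
      exact ⟨p, by omega⟩
    · rintro ⟨p, hp⟩
      have h : H.Reachable c v := p.reachable
      simp only [Set.mem_ofPred_eq, if_pos h]
      exact (SimpleGraph.dist_le p).trans hp

/-- A hole in the coloring of a graph can be filled by changing colors in a ball around it, if the
ball is small. -/
theorem exists_recoloring {V : Type} [Fintype V] {H : SimpleGraph V} {Δ q r : ℕ} (hΔ : 3 ≤ Δ)
    (hdeg : ∀ v, (H.neighborSet v).ncard ≤ Δ) (hq : 2 ≤ q)
    (hfree : Δ + 2 ≤ q → H.CliqueFree (Δ + 1)) (hr : 4 * Nat.clog Δ q ≤ r) {c : V}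
    (hball : (nodeBall H r c).ncard < q) {φ : V → ℕ} (hφ : ∀ v, φ v ∈ Finset.Icc 1 Δ)
    (hprop : ∀ u v, u ≠ c → v ≠ c → H.Adj u v → φ u ≠ φ v) :
    ∃ ψ : V → ℕ, (∀ v, ψ v ∈ Finset.Icc 1 Δ) ∧ (∀ u v, H.Adj u v → ψ u ≠ ψ v) ∧
      ∀ v, v ∉ nodeBall H r c → ψ v = φ v := by
  classical
  by_contra hno
  obtain ⟨lev, hL, hW⟩ := exists_layering H c r
  have hR : IsRigid H Δ {v | lev v ≤ r} φ := ⟨hdeg, by rwa [hW]⟩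
  have hex : ∀ k x, lev x = k → k ≤ r →
      ∃ φ', IsHoleColoring H Δ {v | lev v ≤ r} φ x φ' := by
    intro k
    induction k with
    | zero =>
      intro x hx _
      refine ⟨φ, show lev x ≤ r by omega, hφ, ?_, fun _ _ => rfl⟩
      rw [(hL.eq_zero_iff x).1 hx]
      exact hprop
    | succ k ih =>
      intro x hx hk
      have hxc : x ≠ c := fun e => by have := (hL.eq_zero_iff x).2 e; omega
      obtain ⟨u, hxu, hu⟩ := hL.exists_parent x hxc (by omega)
      obtain ⟨φ', h'⟩ := ih u (by omega) (by omega)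
      exact ⟨_, h'.move hR hxu.symm (show lev x ≤ r by omega)⟩
  have hS : IsStuck H Δ φ c r lev := ⟨hL, hR, fun x hx => hex _ x rfl hx⟩
  have hclog : 1 ≤ Nat.clog Δ q := Nat.clog_pos (by omega) hq
  by_cases hqΔ : Δ + 2 ≤ q
  · have h1 := hS.card_level hΔ (hfree hqΔ) (2 * Nat.clog Δ q) (by omega)
    have h2 : (Finset.univ.filter fun v => lev v = 2 * (2 * Nat.clog Δ q)).card ≤
        (nodeBall H r c).ncard := by
      rw [← Set.ncard_coe_finset, ← hW]
      refine Set.ncard_le_ncard ?_ (Set.toFinite _)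
      intro v hv
      have : lev v = 2 * (2 * Nat.clog Δ q) := by simpa using hv
      show lev v ≤ r
      omega
    -- The factor `4` in the radius: two levels are needed per factor `Δ - 1`, and two such factors
    -- exceed `Δ`.
    have h3 : q ≤ (Δ - 1) ^ (2 * Nat.clog Δ q) := by
      refine (Nat.le_pow_clog (show 1 < Δ by omega) q).trans ?_
      rw [pow_mul]
      refine Nat.pow_le_pow_left ?_ _
      obtain ⟨d, rfl⟩ : ∃ d, Δ = d + 3 := ⟨Δ - 3, by omega⟩
      rw [show d + 3 - 1 = d + 2 by omega]
      nlinarith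
    omega
  -- Here `q ≤ Δ + 1`, and an unfillable hole together with its `Δ` neighbors already has `q` nodes.
  -- No assumption on cliques is needed.
  · obtain ⟨φ', h'⟩ := hS.exists_hole c (by rw [(hL.eq_zero_iff c).2 rfl]; omega)
    have h1 := h'.ncard_eq hR
    have h2 : insert c (H.neighborSet c) ⊆ nodeBall H r c := by
      rintro u (rfl | hu)
      · exact self_mem_nodeBall _ _
      · exact nodeBall_mono (by omega) (mem_nodeBall_of_adj hu)
    have h3 := Set.ncard_le_ncard h2 (Set.toFinite _)
    have h4 : c ∉ H.neighborSet c := fun h => H.irrefl h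
    rw [Set.ncard_insert_of_notMem h4 (Set.toFinite _), h1] at h3
    omega

/-! ### Color reduction with polynomials -/

open Polynomial in
/-- One step of color reduction: from the `M` old colors to `p ^ 2` new ones, if every node has at
most `d` conflicts.  `A` are the old colors that are in conflict with `a`. -/
theorem exists_colorReduction {d k p M : ℕ} (hp : p.Prime) (hdk : d * k < p)
    (hM : M ≤ p ^ (k + 1)) : ∃ F : ℕ → Set ℕ → ℕ, (∀ a A, F a A < p ^ 2) ∧
      ∀ a < M, ∀ b, ∀ A B : Set ℕ, A.Finite → A.ncard ≤ d → (∀ x ∈ A, x < M) → a ∉ A → b ∈ A →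
        F a A ≠ F b B := by
  classical
  have : Fact p.Prime := ⟨hp⟩
  obtain ⟨e⟩ : Nonempty (Fin M ↪ (Fin (k + 1) → ZMod p)) :=
    Function.Embedding.nonempty_of_card_le (by simpa using hM)
  let P : ℕ → (ZMod p)[X] := fun a =>
    if h : a < M then ((degreeLTEquiv (ZMod p) (k + 1)).symm (e ⟨a, h⟩) : (ZMod p)[X]) else 0
  have hPdeg : ∀ a, (P a).natDegree ≤ k := by
    intro a
    by_cases h : a < M
    · simp only [P, dif_pos h]
      have := mem_degreeLT.1 ((degreeLTEquiv (ZMod p) (k + 1)).symm (e ⟨a, h⟩)).2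
      rw [degree_lt_iff_coeff_zero] at this
      exact natDegree_le_iff_coeff_eq_zero.2 fun N hN => this N hN
    · simp [P, h]
  have hPinj : ∀ a < M, ∀ b < M, a ≠ b → P a ≠ P b := by
    intro a ha b hb hab h
    simp only [P, dif_pos ha, dif_pos hb] at h
    have := e.injective ((degreeLTEquiv (ZMod p) (k + 1)).symm.injective (Subtype.ext h))
    exact hab (by simpa using this)
  -- Colors are distinct polynomials of degree at most `k`. Each conflict excludes at most `k`
  -- points, so some point of the field separates `a` from all of `A`.
  have hex : ∀ a < M, ∀ A : Set ℕ, A.Finite → A.ncard ≤ d → (∀ x ∈ A, x < M) → a ∉ A →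
      ∃ x : ZMod p, ∀ b ∈ A, (P a).eval x ≠ (P b).eval x := by
    intro a ha A hA hcard hAM haA
    set bad := hA.toFinset.biUnion fun b => (P a - P b).roots.toFinset with hbad
    have hle : bad.card ≤ d * k := by
      refine (Finset.card_biUnion_le_card_mul _ _ k ?_).trans ?_
      · intro b _
        refine (Multiset.toFinset_card_le _).trans ((card_roots' _).trans ?_)
        exact (natDegree_sub_le _ _).trans (max_le (hPdeg a) (hPdeg b))
      · refine Nat.mul_le_mul_right _ ?_
        rwa [← Set.ncard_eq_toFinset_card A hA]
    obtain ⟨x, hx⟩ : ∃ x, x ∉ bad := by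
      by_contra! hall
      have : bad = Finset.univ := Finset.eq_univ_of_forall hall
      rw [this, Finset.card_univ, ZMod.card] at hle
      omega
    refine ⟨x, fun b hb heq => hx ?_⟩
    rw [hbad, Finset.mem_biUnion]
    refine ⟨b, hA.mem_toFinset.2 hb, ?_⟩
    rw [Multiset.mem_toFinset, mem_roots (sub_ne_zero.2 (hPinj a ha b (hAM b hb) ?_)), IsRoot.def,
      eval_sub, heq, sub_self]
    rintro rfl
    exact haA hb
  let pt : ℕ → Set ℕ → ZMod p := fun a A =>
    if h : ∃ x : ZMod p, ∀ b ∈ A, (P a).eval x ≠ (P b).eval x then h.choose else 0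
  -- The new color encodes a point of the graph of `P a`. If `b` gets the same pair, then `P a` and
  -- `P b` agree at the point chosen for `a`; hence nothing has to be known about the set `B`.
  refine ⟨fun a A => (pt a A).val + p * ((P a).eval (pt a A)).val, ?_, ?_⟩
  · intro a A
    have h1 := (pt a A).val_lt
    have h2 := ((P a).eval (pt a A)).val_lt
    simp only
    nlinarith
  · intro a ha b A B hA hcard hAM haA hbA heq
    have hx := hex a ha A hA hcard hAM haA
    have hspec : ∀ b ∈ A, (P a).eval (pt a A) ≠ (P b).eval (pt a A) := by
      simp only [pt, dif_pos hx]
      exact hx.choose_spec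
    simp only at heq
    have h1 := (pt a A).val_lt
    have h2 := (pt b B).val_lt
    have e1 : (pt a A).val = (pt b B).val := by
      have := congrArg (· % p) heq
      simpa [Nat.add_mul_mod_self_left, Nat.mod_eq_of_lt h1, Nat.mod_eq_of_lt h2] using this
    have e2 : ((P a).eval (pt a A)).val = ((P b).eval (pt b B)).val := by
      rw [e1] at heq
      exact Nat.eq_of_mul_eq_mul_left hp.pos (Nat.add_left_cancel heq)
    have e3 := ZMod.val_injective p e1
    have e4 := ZMod.val_injective p e2
    rw [← e3] at e4
    exact hspec b hbA e4

/-! ### The number of color reductions -/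

theorem logStar_nonempty (x : ℝ) (m : ℕ) (hx : x ≤ m) : ∃ k : ℕ, (Real.logb 2)^[k] x ≤ 1 := by
  induction m generalizing x with
  | zero => exact ⟨0, by simp only [Function.iterate_zero, id]; push_cast at hx; linarith⟩
  | succ m ih =>
    by_cases h2 : x ≤ 2
    · by_cases h1 : x ≤ 1
      · exact ⟨0, by simpa using h1⟩
      · refine ⟨1, ?_⟩
        rw [Function.iterate_one, Real.logb_le_iff_le_rpow one_lt_two (by linarith)]
        simpa using h2
    · push Not at h2
      have h3 : Real.logb 2 x ≤ x - 1 := by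
        rw [Real.logb_le_iff_le_rpow one_lt_two (by linarith)]
        have := one_add_mul_self_le_rpow_one_add (s := (1 : ℝ)) (by norm_num)
          (p := x - 1) (by linarith)
        rw [one_add_one_eq_two] at this
        linarith
      obtain ⟨k, hk⟩ := ih (Real.logb 2 x) (by push_cast at hx; linarith)
      exact ⟨k + 1, by rwa [Function.iterate_succ_apply]⟩

theorem iterate_logStar_le (n : ℕ) : (Real.logb 2)^[logStar n] (n : ℝ) ≤ 1 :=
  Nat.sInf_mem (s := {k : ℕ | (Real.logb 2)^[k] (n : ℝ) ≤ 1})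
    (logStar_nonempty (n : ℝ) n le_rfl)

theorem one_lt_iterate_of_lt_logStar {n t : ℕ} (h : t < logStar n) :
    1 < (Real.logb 2)^[t] (n : ℝ) := by
  by_contra hle
  push Not at hle
  exact absurd (Nat.sInf_le (s := {k : ℕ | (Real.logb 2)^[k] (n : ℝ) ≤ 1}) hle) (by
    unfold logStar at h; omega)

theorem one_le_logStar {n : ℕ} (hn : 2 ≤ n) : 1 ≤ logStar n := by
  by_contra h
  have h0 : logStar n = 0 := by omega
  have := iterate_logStar_le n
  rw [h0, Function.iterate_zero, id] at this
  have h2 : (2 : ℝ) ≤ n := by exact_mod_cast hn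
  linarith

theorem clog_two_le (m : ℕ) (hm : 1 ≤ m) : (Nat.clog 2 m : ℝ) ≤ Real.logb 2 m + 1 := by
  have h := Real.natCeil_logb_natCast 2 m
  rw [← h]
  refine (Nat.ceil_lt_add_one ?_).le
  exact Real.logb_nonneg (by norm_num) (by exact_mod_cast hm)

/-- Bound on the binary length of the colors after a number of color reductions, starting from
length `L`. -/
def colorLength (d L : ℕ) : ℕ → ℕ
  | 0 => L
  | t + 1 => 2 + 2 * Nat.clog 2 d + 2 * Nat.clog 2 (colorLength d L t)

theorem one_le_colorLength {d L : ℕ} (hL : 1 ≤ L) (t : ℕ) : 1 ≤ colorLength d L t := by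
  cases t with
  | zero => exact hL
  | succ t => simp only [colorLength]; omega

/-- The constant in the binary length of the colors after `logStar n` reductions. -/
def lengthConst (c : ℕ) : ℕ := c + 2 + 2 ^ (c + 7)

theorem logb_two_le_self (m : ℝ) (hm : 1 ≤ m) : Real.logb 2 m ≤ m := by
  rw [Real.logb_le_iff_le_rpow one_lt_two (by linarith)]
  have := one_add_mul_self_le_rpow_one_add (s := (1 : ℝ)) (by norm_num) (p := m) hm
  rw [one_add_one_eq_two] at this
  linarith

/-- A reduction turns the length into twice its logarithm plus `O(1 + log d)`. By induction the
length after `t` steps is at most a multiple of the `t`-fold logarithm of `n` plus an error term,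
whose factor `2 ^ (c + 7)` is large enough to reproduce itself. -/
theorem colorLength_logStar_le (c n d : ℕ) :
    colorLength d (c * n + 1) (logStar n) ≤ lengthConst c * (1 + Nat.clog 2 d) := by
  set A : ℝ := 1 + (Nat.clog 2 d : ℝ) with hA
  have hA1 : 1 ≤ A := by rw [hA]; linarith [(Nat.cast_nonneg (Nat.clog 2 d) : (0 : ℝ) ≤ _)]
  set x : ℕ → ℝ := fun t => (Real.logb 2)^[t] (n : ℝ) with hx
  have hc0 : (0 : ℝ) ≤ c := Nat.cast_nonneg c
  have hγ : (8 : ℝ) + 2 * ((c : ℝ) + 2) + 2 * ((c : ℝ) + 7) ≤ 2 ^ (c + 7) := by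
    have : c < 2 ^ c := Nat.lt_two_pow_self
    have h2 : c + 1 ≤ 2 ^ c := this
    have h3 : ((c : ℝ) + 1) ≤ 2 ^ c := by exact_mod_cast h2
    rw [pow_add]
    norm_num
    linarith
  have key : ∀ t ≤ logStar n, (colorLength d (c * n + 1) t : ℝ) ≤
      ((c : ℝ) + 2) * max 1 (x t) + 2 ^ (c + 7) * A := by
    intro t
    induction t with
    | zero =>
      intro _
      simp only [colorLength, hx, Function.iterate_zero, id]
      push_cast
      have h1 : (n : ℝ) ≤ max 1 (n : ℝ) := le_max_right _ _
      have h2 : (1 : ℝ) ≤ max 1 (n : ℝ) := le_max_left _ _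
      have h3 : (0 : ℝ) ≤ 2 ^ (c + 7) * A := by positivity
      nlinarith
    | succ t ih =>
      intro ht
      have ih := ih (by omega)
      have hxt : 1 < x t := one_lt_iterate_of_lt_logStar (by omega)
      rw [max_eq_right hxt.le] at ih
      have hxs : x (t + 1) = Real.logb 2 (x t) := Function.iterate_succ_apply' _ _ _
      set Lt := colorLength d (c * n + 1) t with hLt
      have hL1 : 1 ≤ Lt := one_le_colorLength (by omega) t
      have hL1' : (1 : ℝ) ≤ Lt := by exact_mod_cast hL1
      have e1 := clog_two_le Lt hL1
      have hB : 1 ≤ ((c : ℝ) + 2) * x t := by nlinarith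
      have hG : (1 : ℝ) ≤ 2 ^ (c + 7) * A := by
        have : (1 : ℝ) ≤ 2 ^ (c + 7) := one_le_pow₀ (by norm_num)
        nlinarith
      -- A sum of two numbers that are at least `1` is at most twice their product, which makes the
      -- logarithm split.
      have e2 : (Lt : ℝ) ≤ 2 * (((c : ℝ) + 2) * x t) * (2 ^ (c + 7) * A) := by nlinarith
      have e3 : Real.logb 2 Lt ≤ 1 + (Real.logb 2 ((c : ℝ) + 2) + x (t + 1)) +
          (((c : ℝ) + 7) + Real.logb 2 A) := by
        refine (Real.logb_le_logb_of_le one_lt_two (by linarith) e2).trans (le_of_eq ?_)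
        rw [Real.logb_mul (by positivity) (by positivity), Real.logb_mul (by norm_num)
          (by positivity), Real.logb_mul (by positivity) (by positivity), Real.logb_mul
          (by positivity) (by positivity), hxs, Real.logb_self_eq_one one_lt_two,
          Real.logb_pow, Real.logb_self_eq_one one_lt_two]
        push_cast
        ring
      have e4 := logb_two_le_self ((c : ℝ) + 2) (by linarith)
      have e5 := logb_two_le_self A hA1
      have e6 : x (t + 1) ≤ max 1 (x (t + 1)) := le_max_right _ _
      have e7 : (1 : ℝ) ≤ max 1 (x (t + 1)) := le_max_left _ _
      simp only [colorLength]
      push_cast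
      rw [← hLt]
      have e8 : (2 : ℝ) + 2 * (Nat.clog 2 d : ℝ) = 2 * A := by rw [hA]; ring
      rw [e8]
      have e9 : 2 * max 1 (x (t + 1)) ≤ ((c : ℝ) + 2) * max 1 (x (t + 1)) := by nlinarith
      have e10 : (8 + 2 * ((c : ℝ) + 2) + 2 * ((c : ℝ) + 7)) * A ≤ 2 ^ (c + 7) * A :=
        mul_le_mul_of_nonneg_right hγ (by linarith)
      nlinarith
  have h1 := key _ le_rfl
  rw [max_eq_left (iterate_logStar_le n)] at h1
  have h2 : ((colorLength d (c * n + 1) (logStar n) : ℕ) : ℝ) ≤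
      ((lengthConst c * (1 + Nat.clog 2 d) : ℕ) : ℝ) := by
    refine h1.trans ?_
    unfold lengthConst
    push_cast
    rw [← hA]
    nlinarith
  exact_mod_cast h2

/-! ### Local functions -/

/-- The networks with `n` nodes and maximum degree at most `Δ` that, in case `excl` holds, do not
contain the complete graph on `Δ + 1` nodes. -/
structure Net (c n Δ : ℕ) (excl : Prop) where
  V : Type
  [fintype : Fintype V]
  G : SimpleGraph V
  [decidable : DecidableRel G.Adj]
  ident : V → ℕ
  isNetwork : IsNetwork c n Δ G ident
  cliqueFree : excl → G.CliqueFree (Δ + 1)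

attribute [instance] Net.fintype Net.decidable

/-- What a node can know after a given number of rounds. -/
def ViewType : ℕ → Type
  | 0 => ℕ × ℕ
  | t + 1 => ViewType t × Set (ViewType t)

section Local

variable {c n Δ : ℕ} {excl : Prop}

/-- What `v` knows after `t` rounds, if in each round every node sends everything it knows. -/
def Net.view (N : Net c n Δ excl) : (t : ℕ) → N.V → ViewType t
  | 0 => fun v => (N.ident v, N.G.degree v)
  | t + 1 => fun v => (N.view t v, N.view t '' N.G.neighborSet v)

/-- The value of `f` at a node is determined by what the node can know after `R` rounds. -/
def IsLocal (R : ℕ) {α : Type} (f : (N : Net c n Δ excl) → N.V → α) : Prop :=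
  ∃ g : ViewType R → α, ∀ N v, f N v = g (N.view R v)

variable {α β γ : Type} {R R' : ℕ}

theorem IsLocal.congr {f f' : (N : Net c n Δ excl) → N.V → α} (h : IsLocal R f)
    (e : ∀ N v, f' N v = f N v) : IsLocal R f' := by
  obtain ⟨g, hg⟩ := h
  exact ⟨g, fun N v => (e N v).trans (hg N v)⟩

theorem IsLocal.succ {f : (N : Net c n Δ excl) → N.V → α} (h : IsLocal R f) :
    IsLocal (R + 1) f := by
  obtain ⟨g, hg⟩ := h
  exact ⟨fun w => g w.1, fun N v => hg N v⟩

theorem IsLocal.mono {f : (N : Net c n Δ excl) → N.V → α} (h : IsLocal R f) (hR : R ≤ R') :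
    IsLocal R' f := by
  induction hR with
  | refl => exact h
  | step _ ih => exact ih.succ

theorem IsLocal.map {f : (N : Net c n Δ excl) → N.V → α} (h : IsLocal R f) (F : α → β) :
    IsLocal R fun N v => F (f N v) := by
  obtain ⟨g, hg⟩ := h
  exact ⟨fun w => F (g w), fun N v => congrArg F (hg N v)⟩

theorem IsLocal.map₂ {f : (N : Net c n Δ excl) → N.V → α} {f' : (N : Net c n Δ excl) → N.V → β}
    (h : IsLocal R f) (h' : IsLocal R f') (F : α → β → γ) :
    IsLocal R fun N v => F (f N v) (f' N v) := by
  obtain ⟨g, hg⟩ := h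
  obtain ⟨g', hg'⟩ := h'
  exact ⟨fun w => F (g w) (g' w), fun N v => congrArg₂ F (hg N v) (hg' N v)⟩

theorem IsLocal.pair {f : (N : Net c n Δ excl) → N.V → α} {f' : (N : Net c n Δ excl) → N.V → β}
    (h : IsLocal R f) (h' : IsLocal R f') : IsLocal R fun N v => (f N v, f' N v) :=
  h.map₂ h' Prod.mk

theorem IsLocal.pi {ι : Type} {f : ι → (N : Net c n Δ excl) → N.V → α}
    (h : ∀ i, IsLocal R (f i)) : IsLocal R fun N v i => f i N v := by
  choose g hg using h
  exact ⟨fun w i => g i w, fun N v => funext fun i => hg i N v⟩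

theorem isLocal_const (R : ℕ) (a : α) : IsLocal R fun (N : Net c n Δ excl) (_ : N.V) => a :=
  ⟨fun _ => a, fun _ _ => rfl⟩

theorem isLocal_ident (R : ℕ) : IsLocal R fun (N : Net c n Δ excl) v => N.ident v :=
  IsLocal.mono (R := 0) ⟨fun w => w.1, fun _ _ => rfl⟩ (Nat.zero_le R)

theorem IsLocal.neighbors {f : (N : Net c n Δ excl) → N.V → α} (h : IsLocal R f) :
    IsLocal (R + 1) fun N v => f N '' N.G.neighborSet v := by
  obtain ⟨g, hg⟩ := h
  refine ⟨fun w => g '' w.2, fun N v => ?_⟩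
  show _ = g '' (N.view R '' N.G.neighborSet v)
  rw [Set.image_image]
  exact Set.image_congr fun u _ => hg N u

theorem IsLocal.ball {f : (N : Net c n Δ excl) → N.V → α} (h : IsLocal R f) (s : ℕ) :
    IsLocal (R + s) fun N v => f N '' nodeBall N.G s v := by
  induction s with
  | zero =>
    refine (h.map fun a => ({a} : Set α)).congr fun N v => ?_
    rw [nodeBall_zero, Set.image_singleton]
  | succ s ih =>
    refine (ih.succ.map₂ ih.neighbors fun A B => A ∪ ⋃₀ B).congr fun N v => ?_
    ext a
    constructor
    · rintro ⟨u, hu, rfl⟩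
      rcases mem_nodeBall_succ.1 hu with hu | ⟨w, hw, hu⟩
      · exact Or.inl ⟨u, hu, rfl⟩
      · exact Or.inr ⟨_, ⟨w, hw, rfl⟩, u, hu, rfl⟩
    · rintro (⟨u, hu, rfl⟩ | ⟨_, ⟨w, hw, rfl⟩, u, hu, rfl⟩)
      · exact ⟨u, mem_nodeBall_succ.2 (Or.inl hu), rfl⟩
      · exact ⟨u, mem_nodeBall_succ.2 (Or.inr ⟨w, hw, hu⟩), rfl⟩

/-- The algorithm in which all nodes send everything they know in `R` rounds and then apply `g`. -/
def viewAlgorithm (R : ℕ) (a₀ : α) (g : ViewType R → α) : LocalAlgorithm Unit α where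
  State := Σ t, ViewType t
  Msg := Σ t, ViewType t
  init _ _ ident degree _ := ⟨0, (ident, degree)⟩
  send s _ := s
  receive s inbox := ⟨s.1 + 1, (s.2, {w | ∃ i, inbox i = some ⟨s.1, w⟩})⟩
  -- The state carries its round number; the default `a₀` only makes the output total and does not
  -- occur after exactly `R` rounds.
  output s := if h : s.1 = R then g (h ▸ s.2) else a₀

theorem viewAlgorithm_stateAfter (a₀ : α) (g : ViewType R → α) (N : Net c n Δ excl) (t : ℕ) :
    (viewAlgorithm R a₀ g).stateAfter n Δ N.G N.ident (fun _ => ()) t =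
      fun v => ⟨t, N.view t v⟩ := by
  induction t with
  | zero => rfl
  | succ t ih =>
    funext v
    have hset : {w | ∃ i, (viewAlgorithm R a₀ g).inbox N.G N.ident (fun v => ⟨t, N.view t v⟩) v i =
        some ⟨t, w⟩} = N.view t '' N.G.neighborSet v := by
      ext w
      constructor
      · rintro ⟨i, hi⟩
        unfold LocalAlgorithm.inbox at hi
        split_ifs at hi with h
        have := Option.some.inj hi
        exact ⟨h.choose, h.choose_spec.1, eq_of_heq (Sigma.mk.inj this).2⟩
      · rintro ⟨u, hu, rfl⟩
        have h : ∃ u', N.G.Adj v u' ∧ N.ident u' = N.ident u := ⟨u, hu, rfl⟩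
        refine ⟨N.ident u, ?_⟩
        unfold LocalAlgorithm.inbox
        rw [dif_pos h]
        have e : h.choose = u := N.isNetwork.ident_injective h.choose_spec.2
        show some (⟨t, N.view t h.choose⟩ : Σ t, ViewType t) = _
        rw [e]
        rfl
    rw [LocalAlgorithm.stateAfter, ih]
    show (⟨t + 1, (N.view t v, _)⟩ : Σ t, ViewType t) = ⟨t + 1, (N.view t v, _)⟩
    rw [← hset]
    rfl

theorem IsLocal.exists_algorithm [Nonempty α] {f : (N : Net c n Δ excl) → N.V → α}
    (h : IsLocal R f) : ∃ A : LocalAlgorithm Unit α,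
      ∀ N : Net c n Δ excl, A.run n Δ N.G N.ident (fun _ => ()) R = f N := by
  obtain ⟨g, hg⟩ := h
  obtain ⟨a₀⟩ := ‹Nonempty α›
  refine ⟨viewAlgorithm R a₀ g, fun N => ?_⟩
  funext v
  rw [LocalAlgorithm.run, viewAlgorithm_stateAfter, hg]
  simp [viewAlgorithm]

/-- The subgraph induced by the active nodes; the others are isolated. -/
def activeGraph {V : Type} (G : SimpleGraph V) (act : V → Prop) : SimpleGraph V where
  Adj u v := G.Adj u v ∧ act u ∧ act v
  symm := ⟨fun _ _ h => ⟨h.1.symm, h.2.2, h.2.1⟩⟩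
  loopless := ⟨fun _ h => G.irrefl h.1⟩

theorem activeGraph_le {V : Type} (G : SimpleGraph V) (act : V → Prop) : activeGraph G act ≤ G :=
  fun _ _ h => h.1

noncomputable instance {V : Type} (G : SimpleGraph V) (act : V → Prop) :
    DecidableRel (activeGraph G act).Adj := Classical.decRel _

theorem IsLocal.activeDegree {act : (N : Net c n Δ excl) → N.V → Prop} (h : IsLocal R act) :
    IsLocal (R + 1) fun N v => (activeGraph N.G (act N)).degree v := by
  -- Views record sets of neighbor data without multiplicities, so neighbors are counted by their
  -- identifiers.
  refine (h.succ.map₂ ((h.pair (isLocal_ident R)).neighbors) fun (a : Prop) S =>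
    Set.ncard {i | a ∧ (True, i) ∈ S}).congr fun N v => ?_
  rw [← SimpleGraph.card_neighborFinset_eq_degree, ← Set.ncard_coe_finset,
    ← Set.ncard_image_of_injective _ N.isNetwork.ident_injective]
  congr 1
  ext i
  simp only [SimpleGraph.coe_neighborFinset, Set.mem_image, SimpleGraph.mem_neighborSet,
    Set.mem_ofPred_eq, Prod.mk.injEq, eq_iff_iff, iff_true]
  constructor
  · rintro ⟨u, ⟨hvu, hv, hu⟩, rfl⟩
    exact ⟨hv, u, hvu, hu, rfl⟩
  · rintro ⟨hv, u, hvu, hu, rfl⟩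
    exact ⟨u, ⟨hvu, hv, hu⟩, rfl⟩

-- Simulation of an algorithm on the active subgraph. The extra round tells a node its degree there;
-- the inbox is recovered from the states, activity and identifiers of the neighbors.
open Classical in
theorem IsLocal.run {In Out : Type} (A : LocalAlgorithm In Out)
    {act : (N : Net c n Δ excl) → N.V → Prop} {x : (N : Net c n Δ excl) → N.V → In}
    (h : IsLocal R act) (hx : IsLocal R x) (T : ℕ) :
    IsLocal (R + 1 + T) fun N v => A.run n Δ (activeGraph N.G (act N)) N.ident (x N) T v := by
  suffices hs : ∀ t, IsLocal (R + 1 + t) fun N v =>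
      A.stateAfter n Δ (activeGraph N.G (act N)) N.ident (x N) t v from (hs T).map A.output
  intro t
  induction t with
  | zero =>
    exact ((hx.succ.pair h.activeDegree).pair (isLocal_ident (R + 1))).map fun y =>
      A.init n Δ y.2 y.1.2 y.1.1
  | succ t ih =>
    have hact : IsLocal (R + 1 + t) act := h.mono (by omega)
    refine (((ih.pair (hact.pair (isLocal_ident _))).succ).map₂
      ((ih.pair (hact.pair (isLocal_ident _))).neighbors) fun y S => A.receive y.1 fun i =>
        if h : ∃ s, y.2.1 ∧ (s, True, i) ∈ S then some (A.send h.choose y.2.2) else none).congr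
        fun N v => ?_
    rw [LocalAlgorithm.stateAfter]
    refine congrArg (A.receive _) (funext fun i => ?_)
    unfold LocalAlgorithm.inbox
    by_cases hi : ∃ u, (activeGraph N.G (act N)).Adj v u ∧ N.ident u = i
    · obtain ⟨u, hvu, rfl⟩ := hi
      have h1 : ∃ u', (activeGraph N.G (act N)).Adj v u' ∧ N.ident u' = N.ident u :=
        ⟨u, hvu, rfl⟩
      have e1 : h1.choose = u := N.isNetwork.ident_injective h1.choose_spec.2
      have h2 : ∃ s, act N v ∧ (s, True, N.ident u) ∈
          (fun v => (A.stateAfter n Δ (activeGraph N.G (act N)) N.ident (x N) t v,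
            act N v, N.ident v)) '' N.G.neighborSet v :=
        ⟨_, hvu.2.1, u, hvu.1, by simp only [eq_true hvu.2.2]; rfl⟩
      have e2 : h2.choose = A.stateAfter n Δ (activeGraph N.G (act N)) N.ident (x N) t u := by
        obtain ⟨-, u', hu', he⟩ := h2.choose_spec
        simp only [Prod.mk.injEq] at he
        rw [← he.1, N.isNetwork.ident_injective he.2.2]
      rw [dif_pos h1, dif_pos h2, e1, e2]
    · rw [dif_neg hi, dif_neg]
      rintro ⟨s, hv, u, hu, he⟩
      simp only [Prod.mk.injEq] at he
      exact hi ⟨u, ⟨hu, hv, of_eq_true he.2.1⟩, he.2.2⟩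

end Local

/-! ### Colorings of powers of the network -/

theorem degree_eq_ncard {V : Type} [Fintype V] (G : SimpleGraph V) [DecidableRel G.Adj] (v : V) :
    G.degree v = (G.neighborSet v).ncard := by
  rw [← SimpleGraph.card_neighborFinset_eq_degree, ← Set.ncard_coe_finset,
    SimpleGraph.coe_neighborFinset]

theorem ncard_nodeBall_le {V : Type} [Finite V] {G : SimpleGraph V} {Δ : ℕ}
    (hdeg : ∀ v, (G.neighborSet v).ncard ≤ Δ) (s : ℕ) (v : V) :
    (nodeBall G s v).ncard ≤ (Δ + 1) ^ s := by
  classical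
  have := Fintype.ofFinite V
  induction s generalizing v with
  | zero => simp [nodeBall_zero]
  | succ s ih =>
    set S := (Set.toFinite (insert v (G.neighborSet v))).toFinset with hS
    have hcard : S.card ≤ Δ + 1 := by
      rw [hS, ← Set.ncard_eq_toFinset_card _ (Set.toFinite _)]
      exact (Set.ncard_insert_le _ _).trans (by have := hdeg v; omega)
    have hsub : nodeBall G (s + 1) v ⊆
        ↑(S.biUnion fun w => (Set.toFinite (nodeBall G s w)).toFinset) := by
      intro u hu
      simp only [Finset.coe_biUnion, Set.mem_iUnion, Set.Finite.coe_toFinset, hS]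
      rcases mem_nodeBall_succ.1 hu with h | ⟨w, hw, h⟩
      · exact ⟨v, Set.mem_insert _ _, h⟩
      · exact ⟨w, Set.mem_insert_of_mem _ hw, h⟩
    calc (nodeBall G (s + 1) v).ncard ≤ _ := Set.ncard_le_ncard hsub (Finset.finite_toSet _)
      _ ≤ S.card * (Δ + 1) ^ s := by
          rw [Set.ncard_coe_finset]
          refine Finset.card_biUnion_le_card_mul _ _ _ fun w _ => ?_
          rw [← Set.ncard_eq_toFinset_card _ (Set.toFinite _)]
          exact ih w
      _ ≤ (Δ + 1) ^ (s + 1) := by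
          rw [pow_succ, mul_comm]
          exact Nat.mul_le_mul_left _ hcard

/-- `col` is a coloring with colors below `M` in which two nodes within distance `s` have different
colors. -/
def IsPowerColoring {V : Type} (G : SimpleGraph V) (s M : ℕ) (col : V → ℕ) : Prop :=
  (∀ v, col v < M) ∧ ∀ u v, u ≠ v → u ∈ nodeBall G s v → col u ≠ col v

theorem IsPowerColoring.mono {V : Type} {G : SimpleGraph V} {s M M' : ℕ} {col : V → ℕ}
    (h : IsPowerColoring G s M col) (hM : M ≤ M') : IsPowerColoring G s M' col :=
  ⟨fun v => (h.1 v).trans_le hM, h.2⟩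

section Stages

variable {c n Δ : ℕ} {excl : Prop} {R : ℕ}

theorem Net.ncard_neighborSet_le (N : Net c n Δ excl) (v : N.V) :
    (N.G.neighborSet v).ncard ≤ Δ := by
  rw [← degree_eq_ncard]
  exact (N.G.degree_le_maxDegree v).trans N.isNetwork.maxDegree_le

theorem exists_reducedColoring {s M k p : ℕ} {col : (N : Net c n Δ excl) → N.V → ℕ}
    (hcol : IsLocal R col) (hpc : ∀ N, IsPowerColoring N.G s M (col N)) (hp : p.Prime)
    (hdk : (Δ + 1) ^ s * k < p) (hM : M ≤ p ^ (k + 1)) :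
    ∃ col' : (N : Net c n Δ excl) → N.V → ℕ, IsLocal (R + s) col' ∧
      ∀ N, IsPowerColoring N.G s (p ^ 2) (col' N) := by
  obtain ⟨F, hF1, hF2⟩ := exists_colorReduction hp hdk hM
  refine ⟨fun N v => F (col N v) (col N '' nodeBall N.G s v \ {col N v}),
    (hcol.mono (by omega)).map₂ (hcol.ball s) fun a A => F a (A \ {a}), fun N => ⟨?_, ?_⟩⟩
  · exact fun v => hF1 _ _
  · intro u v huv hb
    refine hF2 _ ((hpc N).1 u) _ _ _ (Set.toFinite _) ?_ ?_ ?_ ?_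
    · refine (Set.ncard_le_ncard Set.sdiff_subset (Set.toFinite _)).trans ?_
      exact (Set.ncard_image_le (Set.toFinite _)).trans
        (ncard_nodeBall_le N.ncard_neighborSet_le s u)
    · rintro _ ⟨⟨w, -, rfl⟩, -⟩
      exact (hpc N).1 w
    · exact fun h => h.2 rfl
    · exact ⟨⟨v, nodeBall_comm.1 hb, rfl⟩, fun h => (hpc N).2 u v huv hb h.symm⟩

theorem exists_powerColoring_length (s t : ℕ) :
    ∃ col : (N : Net c n Δ excl) → N.V → ℕ, IsLocal (s * t) col ∧
      ∀ N, IsPowerColoring N.G s (2 ^ colorLength ((Δ + 1) ^ s) (c * n + 1) t) (col N) := by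
  induction t with
  | zero =>
    refine ⟨fun N v => N.ident v, isLocal_ident _, fun N => ⟨fun v => ?_, ?_⟩⟩
    · have h1 := (Finset.mem_Icc.1 (N.isNetwork.ident_mem v)).2
      have h2 : n ^ c ≤ 2 ^ (c * n) := by
        rw [mul_comm, pow_mul]
        exact Nat.pow_le_pow_left Nat.lt_two_pow_self.le c
      simp only [colorLength]
      rw [pow_succ]
      have : 0 < 2 ^ (c * n) := by positivity
      omega
    · exact fun u v huv _ h => huv (N.isNetwork.ident_injective h)
  | succ t ih =>
    obtain ⟨col, hcol, hpc⟩ := ih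
    set d := (Δ + 1) ^ s with hd
    set L := colorLength d (c * n + 1) t with hL
    have hd1 : 1 ≤ d := Nat.one_le_pow _ _ (by omega)
    have hL1 : 1 ≤ L := one_le_colorLength (by omega) t
    obtain ⟨p, hp, hlt, hle⟩ := Nat.exists_prime_lt_and_le_two_mul (d * L)
      (Nat.mul_pos hd1 hL1).ne'
    obtain ⟨col', hcol', hpc'⟩ := exists_reducedColoring hcol hpc hp hlt
      ((Nat.pow_le_pow_left hp.two_le L).trans (Nat.pow_le_pow_right hp.pos (Nat.le_succ L)))
    refine ⟨col', by rwa [Nat.mul_succ], fun N => (hpc' N).mono ?_⟩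
    have e1 : d ≤ 2 ^ Nat.clog 2 d := Nat.le_pow_clog one_lt_two d
    have e2 : L ≤ 2 ^ Nat.clog 2 L := Nat.le_pow_clog one_lt_two L
    calc p ^ 2 ≤ (2 * (d * L)) ^ 2 := Nat.pow_le_pow_left hle 2
      _ ≤ (2 * (2 ^ Nat.clog 2 d * 2 ^ Nat.clog 2 L)) ^ 2 := by gcongr
      _ = 2 ^ (2 + 2 * Nat.clog 2 d + 2 * Nat.clog 2 L) := by ring

theorem two_pow_clog_le (d : ℕ) (hd : 1 ≤ d) : 2 ^ Nat.clog 2 d ≤ 2 * d := by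
  by_cases h : d = 1
  · subst h; simp
  · have h1 := Nat.pow_pred_clog_lt_self one_lt_two (show 1 < d by omega)
    have h2 : 0 < Nat.clog 2 d := Nat.clog_pos one_lt_two (by omega)
    obtain ⟨m, hm⟩ : ∃ m, Nat.clog 2 d = m + 1 := ⟨Nat.clog 2 d - 1, by omega⟩
    rw [hm] at h1 ⊢
    rw [pow_succ]
    simp only [Nat.pred_eq_sub_one, Nat.add_sub_cancel] at h1
    omega

/-- After `logStar n` reductions there are at most `(4 * d) ^ Γ` colors, with `d = (Δ + 1) ^ s` and
`Γ` depending only on `c`. One more reduction with polynomials of degree at most `Γ` removes the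
remaining logarithm and leaves `O(d ^ 2)` colors. -/
theorem exists_powerColoring (s : ℕ) :
    ∃ col : (N : Net c n Δ excl) → N.V → ℕ, IsLocal (s * (logStar n + 1)) col ∧
      ∀ N, IsPowerColoring N.G s (64 * (lengthConst c * (Δ + 1) ^ s) ^ 2) (col N) := by
  obtain ⟨col, hcol, hpc⟩ := exists_powerColoring_length (c := c) (n := n) (Δ := Δ)
    (excl := excl) s (logStar n)
  set d := (Δ + 1) ^ s with hd
  set Γ := lengthConst c with hΓ
  have hd1 : 1 ≤ d := Nat.one_le_pow _ _ (by omega)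
  have hΓ1 : 1 ≤ Γ := by
    rw [hΓ, lengthConst]
    have : 0 < 2 ^ (c + 7) := by positivity
    omega
  obtain ⟨p, hp, hlt, hle⟩ := Nat.exists_prime_lt_and_le_two_mul (4 * d * Γ) (by positivity)
  have hdp : 4 * d ≤ p := by nlinarith
  have hM : 2 ^ colorLength d (c * n + 1) (logStar n) ≤ p ^ (Γ + 1) :=
    calc 2 ^ colorLength d (c * n + 1) (logStar n) ≤ 2 ^ (Γ * (1 + Nat.clog 2 d)) :=
          Nat.pow_le_pow_right (by norm_num) (colorLength_logStar_le c n d)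
      _ = (2 * 2 ^ Nat.clog 2 d) ^ Γ := by rw [mul_comm Γ, pow_mul, pow_add, pow_one]
      _ ≤ (4 * d) ^ Γ := by
          have := two_pow_clog_le d hd1
          exact Nat.pow_le_pow_left (by omega) Γ
      _ ≤ p ^ Γ := Nat.pow_le_pow_left hdp Γ
      _ ≤ p ^ (Γ + 1) := Nat.pow_le_pow_right hp.pos (Nat.le_succ Γ)
  obtain ⟨col', hcol', hpc'⟩ := exists_reducedColoring (k := Γ) hcol hpc hp (by nlinarith) hM
  refine ⟨col', by rwa [Nat.mul_succ], fun N => (hpc' N).mono ?_⟩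
  calc p ^ 2 ≤ (2 * (4 * d * Γ)) ^ 2 := Nat.pow_le_pow_left hle 2
    _ = 64 * (Γ * d) ^ 2 := by ring

/-! ### Ruling sets, labels and levels -/

/-- The bits of the colors are treated one by one: a candidate whose bit is `1` drops out if a
candidate with bit `0` is within distance `s`. Survivors within distance `s` agree in all bits
treated so far, and each bit adds at most `s` to the distance to a survivor. -/
theorem exists_rulingSet {s b : ℕ} {col : (N : Net c n Δ excl) → N.V → ℕ} (hcol : IsLocal R col)
    (hpc : ∀ N, IsPowerColoring N.G s (2 ^ b) (col N)) :
    ∃ C : (N : Net c n Δ excl) → N.V → Prop, IsLocal (R + b * s) C ∧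
      ∀ N, (∀ u v, C N u → C N v → u ∈ nodeBall N.G s v → u = v) ∧
        ∀ v, ∃ u ∈ nodeBall N.G (b * s) v, C N u := by
  have key : ∀ i, ∃ C : (N : Net c n Δ excl) → N.V → Prop, IsLocal (R + i * s) C ∧
      ∀ N, (∀ u v, C N u → C N v → u ∈ nodeBall N.G s v → ∀ j < i,
          (col N u).testBit j = (col N v).testBit j) ∧
        ∀ v, ∃ u ∈ nodeBall N.G (i * s) v, C N u := by
    intro i
    induction i with
    | zero =>
      exact ⟨fun _ _ => True, isLocal_const _ _, fun N => ⟨by simp,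
        fun v => ⟨v, self_mem_nodeBall _ _, trivial⟩⟩⟩
    | succ i ih =>
      obtain ⟨C, hC, hspec⟩ := ih
      have hbit : IsLocal (R + i * s) fun N v => (col N v).testBit i :=
        (hcol.mono (by omega)).map fun a => a.testBit i
      refine ⟨fun N v => C N v ∧ ((col N v).testBit i = false ∨
          ¬ ∃ u ∈ nodeBall N.G s v, C N u ∧ (col N u).testBit i = false), ?_, fun N => ⟨?_, ?_⟩⟩
      · have h1 := ((hC.pair hbit).mono (show R + i * s ≤ R + i * s + s by omega)).map₂
          ((hC.pair hbit).ball s) fun y S => y.1 ∧ (y.2 = false ∨ ¬ (True, false) ∈ S)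
        rw [Nat.succ_mul, ← Nat.add_assoc]
        refine h1.congr fun N v => ?_
        simp [Set.mem_image]
      · rintro u v ⟨hu, hu'⟩ ⟨hv, hv'⟩ hb j hj
        by_cases hji : j = i
        · subst hji
          cases hbu : (col N u).testBit j <;> cases hbv : (col N v).testBit j
          · rfl
          · rw [hbv] at hv'
            rcases hv' with h | h
            · exact absurd h (by simp)
            · exact absurd ⟨u, hb, hu, hbu⟩ h
          · rw [hbu] at hu'
            rcases hu' with h | h
            · exact absurd h (by simp)
            · exact absurd ⟨v, nodeBall_comm.1 hb, hv, hbv⟩ h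
          · rfl
        · exact (hspec N).1 u v hu hv hb j (by omega)
      · intro v
        obtain ⟨u, hu, hCu⟩ := (hspec N).2 v
        rw [Nat.succ_mul]
        by_cases hex : ∃ w ∈ nodeBall N.G s u, C N w ∧ (col N w).testBit i = false
        · obtain ⟨w, hw, hCw, hbw⟩ := hex
          exact ⟨w, nodeBall_trans hu hw, hCw, Or.inl hbw⟩
        · exact ⟨u, nodeBall_mono (by omega) hu, hCu, Or.inr hex⟩
  obtain ⟨C, hC, hspec⟩ := key b
  refine ⟨C, hC, fun N => ⟨fun u v hu hv hb => ?_, (hspec N).2⟩⟩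
  by_contra hne
  refine (hpc N).2 u v hne hb (Nat.eq_of_testBit_eq fun j => ?_)
  by_cases hj : j < b
  · exact (hspec N).1 u v hu hv hb j hj
  · have hpow : 2 ^ b ≤ 2 ^ j := Nat.pow_le_pow_right (by norm_num) (by omega)
    rw [Nat.testBit_lt_two_pow (((hpc N).1 u).trans_le hpow),
      Nat.testBit_lt_two_pow (((hpc N).1 v).trans_le hpow)]

theorem exists_surjective_label {q : ℕ} {A : Set ℕ} (hA : A.Finite) (hq : q ≤ A.ncard) :
    ∃ e : ℕ → ℕ, ∀ i ∈ Finset.Icc 1 q, ∃ a ∈ A, e a = i := by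
  classical
  rw [Set.ncard_eq_toFinset_card A hA] at hq
  obtain ⟨f⟩ : Nonempty (Fin q ↪ hA.toFinset) :=
    Function.Embedding.nonempty_of_card_le (by simpa using hq)
  refine ⟨fun a => if h : ∃ i, (f i : ℕ) = a then (h.choose : ℕ) + 1 else 0, fun i hi => ?_⟩
  rw [Finset.mem_Icc] at hi
  let j : Fin q := ⟨i - 1, by omega⟩
  refine ⟨f j, hA.mem_toFinset.1 (f j).2, ?_⟩
  have h : ∃ i, (f i : ℕ) = f j := ⟨j, rfl⟩
  have e : h.choose = j := f.injective (Subtype.ext h.choose_spec)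
  simp only [dif_pos h, e, j]
  omega

-- A center with at least `q` nodes in its ball distributes all labels there. The separation makes
-- the balls disjoint, so a node receives labels from one center only; it has label `0` outside
-- these balls.
open Classical in
theorem exists_labels {r q : ℕ} {C : (N : Net c n Δ excl) → N.V → Prop} (hC : IsLocal R C)
    (hsep : ∀ N u v, C N u → C N v → u ∈ nodeBall N.G (2 * r) v → u = v) :
    ∃ (lab : (N : Net c n Δ excl) → N.V → ℕ) (poor : (N : Net c n Δ excl) → N.V → Prop),
      IsLocal (R + 2 * r) lab ∧ IsLocal (R + 2 * r) poor ∧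
      ∀ N, (∀ v, poor N v → C N v ∧ (nodeBall N.G r v).ncard < q) ∧
        ∀ v, C N v → poor N v ∨ ∀ i ∈ Finset.Icc 1 q, ∃ u ∈ nodeBall N.G r v, lab N u = i := by
  have hids : IsLocal (R + r) fun (N : Net c n Δ excl) v => N.ident '' nodeBall N.G r v :=
    (isLocal_ident R).ball r
  have hCr : IsLocal (R + r) C := hC.mono (by omega)
  let idx : Set ℕ → ℕ → ℕ := fun A =>
    if h : ∃ e : ℕ → ℕ, ∀ i ∈ Finset.Icc 1 q, ∃ a ∈ A, e a = i then h.choose else fun _ => 0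
  have hidx : ∀ A : Set ℕ, A.Finite → q ≤ A.ncard → ∀ i ∈ Finset.Icc 1 q, ∃ a ∈ A, idx A a = i := by
    intro A hA hq
    have h := exists_surjective_label hA hq
    simp only [idx, dif_pos h]
    exact h.choose_spec
  have hpay : IsLocal (R + r) fun (N : Net c n Δ excl) v =>
      (C N v ∧ q ≤ (N.ident '' nodeBall N.G r v).ncard, N.ident '' nodeBall N.G r v) :=
    hCr.map₂ hids fun a A => (a ∧ q ≤ A.ncard, A)
  have hncard : ∀ (N : Net c n Δ excl) (v : N.V),
      (N.ident '' nodeBall N.G r v).ncard = (nodeBall N.G r v).ncard := fun N v =>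
    Set.ncard_image_of_injective _ N.isNetwork.ident_injective
  let lab : (N : Net c n Δ excl) → N.V → ℕ := fun N v =>
    if h : ∃ A, (True, A) ∈ (fun v => (C N v ∧ q ≤ (N.ident '' nodeBall N.G r v).ncard,
      N.ident '' nodeBall N.G r v)) '' nodeBall N.G r v then idx h.choose (N.ident v) else 0
  refine ⟨lab, fun N v => C N v ∧ ¬ q ≤ (N.ident '' nodeBall N.G r v).ncard, ?_, ?_,
    fun N => ⟨?_, ?_⟩⟩
  · rw [two_mul, ← Nat.add_assoc]
    exact ((isLocal_ident (R + r + r)).map₂ (hpay.ball r) fun i S =>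
      if h : ∃ A, (True, A) ∈ S then idx h.choose i else 0)
  · exact ((hCr.map₂ hids fun a A => a ∧ ¬ q ≤ A.ncard)).mono (by omega)
  · rintro v ⟨hv, hq⟩
    rw [hncard] at hq
    exact ⟨hv, by omega⟩
  · intro v hv
    by_cases hq : q ≤ (N.ident '' nodeBall N.G r v).ncard
    · right
      intro i hi
      obtain ⟨_, ⟨u, hu, rfl⟩, hi'⟩ := hidx _ (Set.toFinite _) hq i hi
      refine ⟨u, hu, ?_⟩
      have h : ∃ A, (True, A) ∈ (fun v => (C N v ∧ q ≤ (N.ident '' nodeBall N.G r v).ncard,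
          N.ident '' nodeBall N.G r v)) '' nodeBall N.G r u :=
        ⟨_, v, nodeBall_comm.1 hu, by
          simp only [eq_true hv, eq_true hq, and_self]; rfl⟩
      have e : h.choose = N.ident '' nodeBall N.G r v := by
        obtain ⟨w, hw, he⟩ := h.choose_spec
        simp only [Prod.mk.injEq, eq_iff_iff, iff_true] at he
        have hwv : w = v := hsep N w v he.1.1 hv (by
          rw [two_mul]; exact nodeBall_trans hu hw)
        rw [← he.2, hwv]
      simp only [lab, dif_pos h, e, hi']
    · exact Or.inl ⟨hv, hq⟩

theorem exists_levels {D : ℕ} {sink : (N : Net c n Δ excl) → N.V → Prop} (hs : IsLocal R sink)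
    (hD : ∀ N v, ∃ u ∈ nodeBall N.G D v, sink N u) :
    ∃ lev : (N : Net c n Δ excl) → N.V → ℕ, IsLocal (R + D) lev ∧
      ∀ N v, lev N v ≤ D ∧ (sink N v ↔ lev N v = 0) ∧
        (lev N v ≠ 0 → ∃ u, N.G.Adj v u ∧ lev N u < lev N v) := by
  -- The cutoff `t ≤ D` makes the whole family, indexed by all `t`, known after `R + D` rounds.
  have hloc : ∀ t, IsLocal (R + D) fun N v => t ≤ D ∧ ∃ u ∈ nodeBall N.G t v, sink N u := by
    intro t
    by_cases ht : t ≤ D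
    · refine (((hs.ball t).mono (show R + t ≤ R + D by omega)).map fun S => True ∈ S).congr
        fun N v => ?_
      simp [ht]
    · simpa only [ht, false_and] using isLocal_const (R + D) False
  refine ⟨fun N v => sInf {t | t ≤ D ∧ ∃ u ∈ nodeBall N.G t v, sink N u},
    (IsLocal.pi hloc).map fun S => sInf {t | S t}, fun N => ?_⟩
  have hmem : ∀ v : N.V, sInf {t | t ≤ D ∧ ∃ u ∈ nodeBall N.G t v, sink N u} ∈
      {t | t ≤ D ∧ ∃ u ∈ nodeBall N.G t v, sink N u} := fun v =>
    Nat.sInf_mem ⟨D, le_rfl, hD N v⟩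
  intro v
  refine ⟨(hmem v).1, ⟨fun h => ?_, fun h => ?_⟩, fun h => ?_⟩
  · exact Nat.le_zero.1 (Nat.sInf_le ⟨Nat.zero_le _, v, self_mem_nodeBall _ _, h⟩)
  · obtain ⟨-, u, hu, hsu⟩ := hmem v
    simp only at h
    rw [h, nodeBall_zero] at hu
    exact (Set.mem_singleton_iff.1 hu) ▸ hsu
  · obtain ⟨l, hl⟩ := Nat.exists_eq_succ_of_ne_zero h
    obtain ⟨hle, u, hu, hsu⟩ := hmem v
    simp only at hl
    rw [hl] at hu hle
    rcases mem_nodeBall_succ.1 hu with hu | ⟨w, hw, hu⟩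
    · have : sInf {t | t ≤ D ∧ ∃ u ∈ nodeBall N.G t v, sink N u} ≤ l :=
        Nat.sInf_le ⟨by omega, u, hu, hsu⟩
      omega
    · refine ⟨w, hw, ?_⟩
      have : sInf {t | t ≤ D ∧ ∃ u ∈ nodeBall N.G t w, sink N u} ≤ l :=
        Nat.sInf_le ⟨by omega, u, hu, hsu⟩
      simp only
      omega

end Stages

section Coloring

variable {c n Δ : ℕ} {excl : Prop} {R : ℕ}

/-! ### Coloring in the order of a schedule -/

theorem Net.isNetwork_activeGraph (N : Net c n Δ excl) (act : N.V → Prop) :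
    IsNetwork c n Δ (activeGraph N.G act) N.ident where
  card_eq := N.isNetwork.card_eq
  maxDegree_le := by
    refine SimpleGraph.maxDegree_le_of_forall_degree_le _ _ fun v => ?_
    rw [degree_eq_ncard]
    exact (Set.ncard_le_ncard (fun u hu => hu.1) (Set.toFinite _)).trans
      (N.ncard_neighborSet_le v)
  ident_mem := N.isNetwork.ident_mem
  ident_injective := N.isNetwork.ident_injective

open Classical in
/-- If every node has a neighbor that comes later, then the nodes can be colored greedily in the
order of the schedule `τ`. -/
theorem exists_scheduledColoring {m T J : ℕ} (hΔ : 1 ≤ Δ) (hA : ListColoringInTime c m n Δ T)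
    {τ col : (N : Net c n Δ excl) → N.V → ℕ} (hτ : IsLocal R τ) (hcol : IsLocal R col)
    (hcm : ∀ N v, col N v ∈ Finset.Icc 1 m)
    (hprop : ∀ N u v, N.G.Adj u v → τ N u = τ N v → col N u ≠ col N v)
    (hup : ∀ N v, τ N v < J → ∃ u, N.G.Adj v u ∧ τ N v < τ N u) :
    ∃ f : (N : Net c n Δ excl) → N.V → ℕ, IsLocal (R + J * (T + 2)) f ∧
      ∀ N, (∀ v, f N v ∈ Finset.Icc 1 Δ) ∧
        ∀ u v, N.G.Adj u v → τ N u < J → τ N v < J → f N u ≠ f N v := by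
  obtain ⟨A, hA⟩ := hA
  suffices key : ∀ j ≤ J, ∃ f : (N : Net c n Δ excl) → N.V → ℕ, IsLocal (R + j * (T + 2)) f ∧
      ∀ N, (∀ v, f N v ∈ Finset.Icc 1 Δ) ∧
        ∀ u v, N.G.Adj u v → τ N u < j → τ N v < j → f N u ≠ f N v from key J le_rfl
  intro j
  induction j with
  | zero =>
    intro _
    exact ⟨fun _ _ => 1, isLocal_const _ _, fun N => ⟨fun v => by simpa using hΔ, by simp⟩⟩
  | succ j ih =>
    intro hj
    obtain ⟨f, hf, hspec⟩ := ih (by omega)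
    set Q := R + j * (T + 2) with hQ
    let L : (N : Net c n Δ excl) → N.V → Finset ℕ := fun N v =>
      if τ N v = j then (Finset.Icc 1 Δ).filter fun a => ¬ ∃ u, N.G.Adj v u ∧ τ N u < j ∧ f N u = a
      else Finset.Icc 1 Δ
    have hτQ : IsLocal Q τ := hτ.mono (by omega)
    have hτQ1 : IsLocal (Q + 1) τ := hτQ.succ
    have hL : IsLocal (Q + 1) L := by
      refine (hτQ1.map₂ ((hτQ.pair hf).neighbors) fun t S => if t = j then
        (Finset.Icc 1 Δ).filter fun a => ¬ ∃ t', t' < j ∧ (t', a) ∈ S else Finset.Icc 1 Δ).congr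
        fun N v => ?_
      simp only [L]
      split_ifs
      · refine Finset.filter_congr fun a _ => not_congr ⟨?_, ?_⟩
        · rintro ⟨u, hu, ht, rfl⟩
          exact ⟨_, ht, u, hu, rfl⟩
        · rintro ⟨t, ht, u, hu, he⟩
          simp only [Prod.mk.injEq] at he
          exact ⟨u, hu, he.1 ▸ ht, he.2⟩
      · rfl
    have hcolQ : IsLocal (Q + 1) col := hcol.mono (by omega)
    have hact : IsLocal (Q + 1) fun (N : Net c n Δ excl) v => τ N v = j := hτQ1.map (· = j)
    have hrun := IsLocal.run A hact (hcolQ.pair hL) T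
    have hlist : ∀ N : Net c n Δ excl, IsListColoring (activeGraph N.G fun v => τ N v = j) (L N)
        (A.run n Δ (activeGraph N.G fun v => τ N v = j) N.ident
          (fun v => (col N v, L N v)) T) := by
      intro N
      refine hA N.V _ N.ident (col N) (L N) (N.isNetwork_activeGraph _)
        ⟨hcm N, fun u v h => hprop N u v h.1 (h.2.1.trans h.2.2.symm)⟩ fun v => ?_
      rw [degree_eq_ncard]
      by_cases hv : τ N v = j
      · obtain ⟨w, hvw, hw⟩ := hup N v (by omega)
        set B : Set N.V := {u | N.G.Adj v u ∧ τ N u < j} with hB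
        set A' := (activeGraph N.G fun v => τ N v = j).neighborSet v with hA'
        have hdis : Disjoint A' B := Set.disjoint_left.2 fun u hu hu' => by
          have h1 : τ N u = j := hu.2.2
          have h2 := hu'.2
          omega
        have hw' : w ∉ A' ∪ B := by
          rintro (h | h)
          · have : τ N w = j := h.2.2
            omega
          · have := h.2
            omega
        -- The later neighbor `w` is neither active nor colored. It saves one color, so that the
        -- list exceeds the active degree.
        have hsub : insert w (A' ∪ B) ⊆ N.G.neighborSet v := by
          rintro u (rfl | hu | hu)
          · exact hvw
          · exact hu.1
          · exact hu.1
        have h1 := (Set.ncard_le_ncard hsub (Set.toFinite _)).trans (N.ncard_neighborSet_le v)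
        rw [Set.ncard_insert_of_notMem hw' (Set.toFinite _),
          Set.ncard_union_eq hdis (Set.toFinite _) (Set.toFinite _)] at h1
        have hcov : (Finset.Icc 1 Δ : Set ℕ) ⊆ ↑(L N v) ∪ f N '' B := by
          intro a ha
          by_cases hex : ∃ u, N.G.Adj v u ∧ τ N u < j ∧ f N u = a
          · obtain ⟨u, hu, ht, rfl⟩ := hex
            exact Or.inr ⟨u, ⟨hu, ht⟩, rfl⟩
          · refine Or.inl ?_
            simp only [L, if_pos hv, Finset.coe_filter]
            exact ⟨ha, hex⟩
        have h2 := (Set.ncard_le_ncard hcov (Set.toFinite _)).trans (Set.ncard_union_le _ _)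
        have h3 := Set.ncard_image_le (f := f N) (Set.toFinite B)
        rw [Set.ncard_coe_finset, Set.ncard_coe_finset, Nat.card_Icc] at h2
        omega
      · have hempty : (activeGraph N.G fun v => τ N v = j).neighborSet v = ∅ :=
          Set.eq_empty_of_forall_notMem fun u hu => hv hu.2.1
        rw [hempty, Set.ncard_empty]
        simp only [L, if_neg hv, Nat.card_Icc]
        omega
    refine ⟨fun N v => if τ N v = j then A.run n Δ (activeGraph N.G fun v => τ N v = j) N.ident
      (fun v => (col N v, L N v)) T v else f N v, ?_, fun N => ⟨?_, ?_⟩⟩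
    · have h1 := (hrun.pair (hτ.mono (show R ≤ Q + 1 + 1 + T by omega))).map₂
        (hf.mono (show Q ≤ Q + 1 + 1 + T by omega)) fun y a => if y.2 = j then y.1 else a
      refine h1.mono ?_
      rw [Nat.succ_mul]
      omega
    · intro v
      simp only
      split_ifs with hv
      · have := (hlist N).1 v
        simp only [L, if_pos hv] at this
        exact (Finset.mem_filter.1 this).1
      · exact (hspec N).1 v
    · have hmix : ∀ u v, N.G.Adj u v → τ N u = j → τ N v < j →
          A.run n Δ (activeGraph N.G fun v => τ N v = j) N.ident
            (fun v => (col N v, L N v)) T u ≠ f N v := by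
        intro u v huv hu hv he
        have := (hlist N).1 u
        simp only [L, if_pos hu] at this
        exact (Finset.mem_filter.1 this).2 ⟨v, huv, hv, he.symm⟩
      intro u v huv hu hv
      simp only
      split_ifs with h1 h2 h2
      · exact (hlist N).2 u v ⟨huv, h1, h2⟩
      · exact hmix u v huv h1 (by omega)
      · exact (hmix v u huv.symm h2 (by omega)).symm
      · exact (hspec N).2 u v huv (by omega) (by omega)

/-! ### Filling the holes -/

/-- The colors `ψ`, indexed by identifiers, extend a coloring to the ball that is described by `D`:
every node of the ball is given by its identifier, its old color and whether it is to be ignored,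
together with the same data for its neighbors. -/
def IsBallColoring (Δ : ℕ) (D : Set ((ℕ × ℕ × Prop) × Set (ℕ × ℕ × Prop))) (ψ : ℕ → ℕ) : Prop :=
  (∀ x ∈ D, ψ x.1.1 ∈ Finset.Icc 1 Δ) ∧ ∀ x ∈ D, ∀ y ∈ x.2, ¬ x.1.2.2 → ¬ y.2.2 →
    ((∃ z ∈ D, z.1.1 = y.1) → ψ x.1.1 ≠ ψ y.1) ∧ ((¬ ∃ z ∈ D, z.1.1 = y.1) → ψ x.1.1 ≠ y.2.1)

/-- The description of the ball of radius `r` around `v`. -/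
def ballData (N : Net c n Δ excl) (f : N.V → ℕ) (dead : N.V → Prop) (r : ℕ) (v : N.V) :
    Set ((ℕ × ℕ × Prop) × Set (ℕ × ℕ × Prop)) :=
  (fun u => ((N.ident u, f u, dead u), (fun w => (N.ident w, f w, dead w)) '' N.G.neighborSet u)) ''
    nodeBall N.G r v

theorem isBallColoring_ballData {N : Net c n Δ excl} {f : N.V → ℕ} {dead : N.V → Prop} {r : ℕ}
    {v : N.V} {ψ : ℕ → ℕ} : IsBallColoring Δ (ballData N f dead r v) ψ ↔
      (∀ u ∈ nodeBall N.G r v, ψ (N.ident u) ∈ Finset.Icc 1 Δ) ∧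
      ∀ u ∈ nodeBall N.G r v, ∀ w, N.G.Adj u w → ¬ dead u → ¬ dead w →
        (w ∈ nodeBall N.G r v → ψ (N.ident u) ≠ ψ (N.ident w)) ∧
        (w ∉ nodeBall N.G r v → ψ (N.ident u) ≠ f w) := by
  have hmem : ∀ w, (∃ z ∈ ballData N f dead r v, z.1.1 = N.ident w) ↔ w ∈ nodeBall N.G r v := by
    intro w
    constructor
    · rintro ⟨_, ⟨u, hu, rfl⟩, he⟩
      exact N.isNetwork.ident_injective he ▸ hu
    · exact fun hw => ⟨_, ⟨w, hw, rfl⟩, rfl⟩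
  constructor
  · rintro ⟨h1, h2⟩
    refine ⟨fun u hu => h1 _ ⟨u, hu, rfl⟩, fun u hu w huw hdu hdw => ?_⟩
    have := h2 _ ⟨u, hu, rfl⟩ _ ⟨w, huw, rfl⟩ hdu hdw
    rwa [hmem w] at this
  · rintro ⟨h1, h2⟩
    constructor
    · rintro _ ⟨u, hu, rfl⟩
      exact h1 u hu
    · rintro _ ⟨u, hu, rfl⟩ _ ⟨w, huw, rfl⟩ hdu hdw
      rw [hmem w]
      exact h2 u hu w huw hdu hdw

/-- Recoloring takes place in the graph without the dead nodes and without the other poor ones,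
where `v` is the only hole. By the separation, the other poor nodes are neither in the ball nor
adjacent to it; balls of the subgraph are only smaller. -/
theorem exists_ballColoring {r q : ℕ} (hΔ : 3 ≤ Δ) (hq : 2 ≤ q) (hexcl : Δ + 2 ≤ q → excl)
    (hr : 4 * Nat.clog Δ q ≤ r) (N : Net c n Δ excl) {f : N.V → ℕ} {dead poor : N.V → Prop}
    (hsep : ∀ u v, poor u → poor v → u ∈ nodeBall N.G (2 * r + 1) v → u = v)
    (hf : ∀ v, f v ∈ Finset.Icc 1 Δ) (hfp : ∀ u v, N.G.Adj u v → ¬ dead u → ¬ dead v →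
      ¬ poor u → ¬ poor v → f u ≠ f v) {v : N.V} (hv : poor v)
    (hsmall : (nodeBall N.G r v).ncard < q) :
    ∃ ψ, IsBallColoring Δ (ballData N f dead r v) ψ := by
  classical
  set H := activeGraph N.G fun u => ¬ dead u ∧ (poor u → u = v) with hH
  have hHG : H ≤ N.G := activeGraph_le _ _
  obtain ⟨ψ, h1, h2, h3⟩ := exists_recoloring (H := H) (c := v) (φ := f) hΔ
    (fun u => (Set.ncard_le_ncard (fun w hw => hw.1) (Set.toFinite _)).trans
      (N.ncard_neighborSet_le u)) hq (fun h => (N.cliqueFree (hexcl h)).anti hHG) hr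
    ((Set.ncard_le_ncard (nodeBall_mono_graph hHG) (Set.toFinite _)).trans_lt hsmall) hf
    (fun u w hu hw huw => hfp u w huw.1 huw.2.1.1 huw.2.2.1 (fun h => hu (huw.2.1.2 h))
      fun h => hw (huw.2.2.2 h))
  refine ⟨fun i => if h : ∃ u, N.ident u = i then ψ h.choose else 1, ?_⟩
  have hval : ∀ u, (if h : ∃ u', N.ident u' = N.ident u then ψ h.choose else 1) = ψ u := by
    intro u
    have h : ∃ u', N.ident u' = N.ident u := ⟨u, rfl⟩
    rw [dif_pos h, N.isNetwork.ident_injective h.choose_spec]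
  rw [isBallColoring_ballData]
  simp only [hval]
  refine ⟨fun u _ => h1 u, fun u hu w huw hdu hdw => ?_⟩
  have hw : w ∈ nodeBall N.G (2 * r + 1) v := by
    refine nodeBall_mono (show r + 1 ≤ 2 * r + 1 by omega)
      (nodeBall_trans hu (mem_nodeBall_of_adj huw))
  have hadj : H.Adj u w :=
    ⟨huw, ⟨hdu, fun h => hsep u v h hv (nodeBall_mono (by omega) hu)⟩,
      hdw, fun h => hsep w v h hv hw⟩
  refine ⟨fun _ => h2 u w hadj, fun hwn => ?_⟩
  rw [← h3 w fun h => hwn (nodeBall_mono_graph hHG h)]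
  exact h2 u w hadj

open Classical in
/-- A coloring of the nodes that are neither dead nor poor is turned into one of all nodes that are
not dead, if the balls around the poor nodes are small and far apart. -/
theorem exists_filledColoring {r q : ℕ} (hΔ : 3 ≤ Δ) (hq : 2 ≤ q) (hexcl : Δ + 2 ≤ q → excl)
    (hr : 4 * Nat.clog Δ q ≤ r) {f : (N : Net c n Δ excl) → N.V → ℕ}
    {dead poor : (N : Net c n Δ excl) → N.V → Prop} (hfl : IsLocal R f) (hdl : IsLocal R dead)
    (hpl : IsLocal R poor)
    (hsep : ∀ N u v, poor N u → poor N v → u ∈ nodeBall N.G (2 * r + 1) v → u = v)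
    (hsmall : ∀ N v, poor N v → (nodeBall N.G r v).ncard < q)
    (hf : ∀ N v, f N v ∈ Finset.Icc 1 Δ)
    (hfp : ∀ N u v, N.G.Adj u v → ¬ dead N u → ¬ dead N v → ¬ poor N u → ¬ poor N v →
      f N u ≠ f N v) :
    ∃ g : (N : Net c n Δ excl) → N.V → ℕ, IsLocal (R + (2 * r + 1)) g ∧
      ∀ N, (∀ v, g N v ∈ Finset.Icc 1 Δ) ∧
        ∀ u v, N.G.Adj u v → ¬ dead N u → ¬ dead N v → g N u ≠ g N v := by
  have hdata : IsLocal (R + 1 + r) fun N v => ballData N (f N) (dead N) r v := by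
    have h1 := (isLocal_ident R).pair (hfl.pair hdl)
    exact (h1.succ.pair h1.neighbors).ball r
  -- The choice depends on the data alone, so all nodes of a ball use the same recoloring.
  let o : Set ((ℕ × ℕ × Prop) × Set (ℕ × ℕ × Prop)) → ℕ → ℕ := fun D =>
    if h : ∃ ψ, IsBallColoring Δ D ψ then h.choose else fun _ => 1
  let S : (N : Net c n Δ excl) → N.V → Set (Prop × (ℕ → ℕ)) := fun N v =>
    (fun u => (poor N u, o (ballData N (f N) (dead N) r u))) '' nodeBall N.G r v
  have hS : IsLocal (R + (2 * r + 1)) S := by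
    have h1 := ((hpl.mono (show R ≤ R + 1 + r by omega)).pair (hdata.map o)).ball r
    exact h1.mono (by omega)
  have ho : ∀ N v, poor N v → IsBallColoring Δ (ballData N (f N) (dead N) r v)
      (o (ballData N (f N) (dead N) r v)) := by
    intro N v hv
    have h := exists_ballColoring hΔ hq hexcl hr N (hsep N) (hf N) (hfp N) hv (hsmall N v hv)
    simp only [o, dif_pos h]
    exact h.choose_spec
  let g : (N : Net c n Δ excl) → N.V → ℕ := fun N v =>
    if h : ∃ ψ, (True, ψ) ∈ S N v then h.choose (N.ident v) else f N v
  have hin : ∀ N v w, poor N w → v ∈ nodeBall N.G r w →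
      g N v = o (ballData N (f N) (dead N) r w) (N.ident v) := by
    intro N v w hw hvw
    have h : ∃ ψ, (True, ψ) ∈ S N v :=
      ⟨_, w, nodeBall_comm.1 hvw, by simp only [eq_true hw]; rfl⟩
    obtain ⟨w', hw', he⟩ := h.choose_spec
    simp only [Prod.mk.injEq, eq_iff_iff, iff_true] at he
    have hww : w' = w := hsep N w' w he.1 hw
      (nodeBall_mono (show r + r ≤ 2 * r + 1 by omega) (nodeBall_trans hvw hw'))
    simp only [g, dif_pos h]
    rw [← he.2, hww]
  have hout : ∀ N v, (¬ ∃ w, poor N w ∧ v ∈ nodeBall N.G r w) → g N v = f N v := by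
    intro N v hv
    have h : ¬ ∃ ψ, (True, ψ) ∈ S N v := by
      rintro ⟨ψ, w, hw, he⟩
      simp only [Prod.mk.injEq, eq_iff_iff, iff_true] at he
      exact hv ⟨w, he.1, nodeBall_comm.1 hw⟩
    simp only [g, dif_neg h]
  refine ⟨g, ?_, fun N => ⟨fun v => ?_, ?_⟩⟩
  · exact (((isLocal_ident _).pair (hfl.mono (by omega))).map₂ hS fun y A =>
      if h : ∃ ψ, (True, ψ) ∈ A then h.choose y.1 else y.2)
  · by_cases hv : ∃ w, poor N w ∧ v ∈ nodeBall N.G r w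
    · obtain ⟨w, hw, hvw⟩ := hv
      rw [hin N v w hw hvw]
      exact (isBallColoring_ballData.1 (ho N w hw)).1 v hvw
    · rw [hout N v hv]
      exact hf N v
  · have hmix : ∀ u v, N.G.Adj u v → ¬ dead N u → ¬ dead N v →
        (∃ w, poor N w ∧ u ∈ nodeBall N.G r w) → g N u ≠ g N v := by
      rintro u v huv hdu hdv ⟨w, hw, huw⟩
      have hspec := (isBallColoring_ballData.1 (ho N w hw)).2 u huw v huv hdu hdv
      rw [hin N u w hw huw]
      by_cases hv : ∃ w, poor N w ∧ v ∈ nodeBall N.G r w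
      · obtain ⟨w', hw', hvw'⟩ := hv
        have hww : w' = w := hsep N w' w hw' hw
          (nodeBall_mono (show r + 1 + r ≤ 2 * r + 1 by omega) (nodeBall_trans
            (nodeBall_trans huw (mem_nodeBall_of_adj huv)) (nodeBall_comm.1 hvw')))
        subst hww
        rw [hin N v w' hw' hvw']
        exact hspec.1 hvw'
      · rw [hout N v hv]
        exact hspec.2 fun h => hv ⟨w, hw, h⟩
    intro u v huv hdu hdv
    by_cases hu : ∃ w, poor N w ∧ u ∈ nodeBall N.G r w
    · exact hmix u v huv hdu hdv hu
    by_cases hv : ∃ w, poor N w ∧ v ∈ nodeBall N.G r w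
    · exact (hmix v u huv.symm hdv hdu hv).symm
    rw [hout N u hu, hout N v hv]
    exact hfp N u v huv hdu hdv (fun h => hu ⟨u, h, self_mem_nodeBall _ _⟩)
      fun h => hv ⟨v, h, self_mem_nodeBall _ _⟩

end Coloring

/-! ### The multicoloring -/

section Assembly

variable {c n Δ : ℕ} {excl : Prop}

theorem IsLocal.multicoloringInTime {p q R : ℕ} {X : (N : Net c n Δ excl) → N.V → Finset ℕ}
    (hX : IsLocal R X) (h : ∀ N, IsMulticoloring N.G p q (X N)) :
    MulticoloringInTime c n Δ p q excl R := by
  obtain ⟨A, hA⟩ := hX.exists_algorithm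
  refine ⟨A, fun V _ G _ ident hN hfree => ?_⟩
  have := h ⟨V, G, ident, hN, hfree⟩
  rwa [← hA] at this

theorem block_injective {i j x y : ℕ} (hi : 1 ≤ i) (hj : 1 ≤ j) (hx : x ∈ Finset.Icc 1 Δ)
    (hy : y ∈ Finset.Icc 1 Δ) (h : (i - 1) * Δ + x = (j - 1) * Δ + y) : i = j ∧ x = y := by
  rw [Finset.mem_Icc] at hx hy
  have key : i = j := by
    rcases lt_trichotomy i j with hlt | rfl | hlt
    · have : (i - 1 + 1) * Δ ≤ (j - 1) * Δ := Nat.mul_le_mul_right Δ (by omega)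
      rw [Nat.succ_mul] at this
      omega
    · rfl
    · have : (j - 1 + 1) * Δ ≤ (i - 1) * Δ := Nat.mul_le_mul_right Δ (by omega)
      rw [Nat.succ_mul] at this
      omega
  subst key
  exact ⟨rfl, by omega⟩

/-- A multicoloring from colorings with `Δ` colors, one for each of `q` blocks of colors, such that
each node takes part in all of them but at most one. -/
theorem isMulticoloring_blocks {V : Type} {G : SimpleGraph V} {q : ℕ} {lab : V → ℕ}
    {g : ℕ → V → ℕ} (hg : ∀ i ∈ Finset.Icc 1 q, (∀ v, g i v ∈ Finset.Icc 1 Δ) ∧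
      ∀ u v, G.Adj u v → lab u ≠ i → lab v ≠ i → g i u ≠ g i v) :
    IsMulticoloring G (q * Δ) (q - 1) fun v =>
      ((Finset.Icc 1 q).erase (lab v)).image fun i => (i - 1) * Δ + g i v := by
  refine ⟨fun v x hx => ?_, fun v => ?_, fun u v huv => ?_⟩
  · obtain ⟨i, hi, rfl⟩ := Finset.mem_image.1 hx
    have hi' := Finset.mem_of_mem_erase hi
    have h1 := Finset.mem_Icc.1 ((hg i hi').1 v)
    rw [Finset.mem_Icc] at hi' ⊢
    have h2 : (i - 1 + 1) * Δ ≤ q * Δ := Nat.mul_le_mul_right Δ (by omega)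
    rw [Nat.succ_mul] at h2
    omega
  · rw [Finset.card_image_of_injOn]
    · refine le_trans ?_ Finset.pred_card_le_card_erase
      simp
    · intro i hi j hj h
      have hi' := Finset.mem_of_mem_erase hi
      have hj' := Finset.mem_of_mem_erase hj
      exact (block_injective (Finset.mem_Icc.1 hi').1 (Finset.mem_Icc.1 hj').1 ((hg i hi').1 v)
        ((hg j hj').1 v) h).1
  · rw [Finset.disjoint_left]
    intro x hu hv
    obtain ⟨i, hi, rfl⟩ := Finset.mem_image.1 hu
    obtain ⟨j, hj, h⟩ := Finset.mem_image.1 hv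
    have hi' := Finset.mem_of_mem_erase hi
    have hj' := Finset.mem_of_mem_erase hj
    obtain ⟨rfl, h⟩ := block_injective (Finset.mem_Icc.1 hj').1 (Finset.mem_Icc.1 hi').1
      ((hg j hj').1 v) ((hg i hi').1 u) h
    exact (hg j hj').2 u v huv (Finset.ne_of_mem_erase hi).symm (Finset.ne_of_mem_erase hj).symm
      h.symm

/-- The number of bits of the colors of a power of the network. -/
def colorBits (c Δ s : ℕ) : ℕ :=
  6 + 2 * Nat.clog 2 (lengthConst c) + 2 * s * Nat.clog 2 (Δ + 1)

theorem powerColors_le (c Δ s : ℕ) :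
    64 * (lengthConst c * (Δ + 1) ^ s) ^ 2 ≤ 2 ^ colorBits c Δ s := by
  have e1 := Nat.le_pow_clog one_lt_two (lengthConst c)
  have e2 := Nat.le_pow_clog one_lt_two (Δ + 1)
  calc 64 * (lengthConst c * (Δ + 1) ^ s) ^ 2
      ≤ 64 * (2 ^ Nat.clog 2 (lengthConst c) * (2 ^ Nat.clog 2 (Δ + 1)) ^ s) ^ 2 := by gcongr
    _ = 2 ^ colorBits c Δ s := by
        rw [colorBits, pow_add, pow_add]
        norm_num
        ring

/-- The distance within which every node finds a sink. -/
def sinkDist (c Δ r : ℕ) : ℕ := colorBits c Δ (2 * r + 2) * (2 * r + 2) + r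

/-- The number of classes of colors into which the given coloring is split. -/
def classCount (c : ℕ) : ℕ := 256 * lengthConst c ^ 2

/-- The number of rounds of the multicoloring algorithm. -/
noncomputable def roundCount (c n Δ T r : ℕ) : ℕ :=
  (2 * r + 2) * (logStar n + 1) + colorBits c Δ (2 * r + 2) * (2 * r + 2) + 2 * r +
    sinkDist c Δ r + sinkDist c Δ r * classCount c * (T + 2) + (2 * r + 1)

/-- The available coloring may use more than `C * Δ ^ 2` colors. Its colors are split by their
quotient modulo `C * Δ ^ 2` into boundedly many classes that take turns within a level, and the
remainder is the input color. Far levels come first, and sinks come at time `D * classCount c` or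
later. -/
theorem exists_schedule {C R D : ℕ} (hC : 1 ≤ C) (hΔ : 3 ≤ Δ) (hR : logStar n + 1 ≤ R)
    {sink : (N : Net c n Δ excl) → N.V → Prop} (hs : IsLocal R sink)
    (hD : ∀ N v, ∃ u ∈ nodeBall N.G D v, sink N u) :
    ∃ τ col : (N : Net c n Δ excl) → N.V → ℕ, IsLocal (R + D) τ ∧ IsLocal (R + D) col ∧
      ∀ N, (∀ v, col N v ∈ Finset.Icc 1 (C * Δ ^ 2)) ∧
        (∀ u v, N.G.Adj u v → τ N u = τ N v → col N u ≠ col N v) ∧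
        (∀ v, τ N v < D * classCount c ↔ ¬ sink N v) ∧
        ∀ v, ¬ sink N v → ∃ u, N.G.Adj v u ∧ τ N v < τ N u := by
  obtain ⟨lev, hlev, hlspec⟩ := exists_levels hs hD
  obtain ⟨bc, hbc, hbspec⟩ := exists_powerColoring (c := c) (n := n) (Δ := Δ) (excl := excl) 1
  have hbc' : IsLocal (R + D) bc := hbc.mono (by omega)
  set M := classCount c with hM
  have hm : 0 < C * Δ ^ 2 := by positivity
  have hdiv : ∀ N v, bc N v / (C * Δ ^ 2) < M := by
    intro N v
    refine Nat.div_lt_of_lt_mul (((hbspec N).1 v).trans_le ?_)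
    rw [hM, classCount, pow_one, mul_pow]
    have h1 : (Δ + 1) ^ 2 ≤ 4 * Δ ^ 2 := by nlinarith
    calc 64 * (lengthConst c ^ 2 * (Δ + 1) ^ 2) ≤ 64 * (lengthConst c ^ 2 * (4 * Δ ^ 2)) := by
          gcongr
      _ = 1 * Δ ^ 2 * (256 * lengthConst c ^ 2) := by ring
      _ ≤ C * Δ ^ 2 * (256 * lengthConst c ^ 2) := by gcongr
  have hlt : ∀ N v l, D - lev N v < l →
      (D - lev N v) * M + bc N v / (C * Δ ^ 2) < l * M := by
    intro N v l hl
    have h1 := hdiv N v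
    have h2 : (D - lev N v + 1) * M ≤ l * M := Nat.mul_le_mul_right M hl
    rw [Nat.succ_mul] at h2
    omega
  refine ⟨fun N v => (D - lev N v) * M + bc N v / (C * Δ ^ 2),
    fun N v => bc N v % (C * Δ ^ 2) + 1, ?_, ?_, fun N => ⟨fun v => ?_, ?_, fun v => ?_, ?_⟩⟩
  · exact hlev.map₂ hbc' fun l b => (D - l) * M + b / (C * Δ ^ 2)
  · exact hbc'.map fun b => b % (C * Δ ^ 2) + 1
  · exact Finset.mem_Icc.2 ⟨Nat.le_add_left _ _, Nat.mod_lt (bc N v) hm⟩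
  · intro u v huv hτ hcol
    have h1 : bc N u / (C * Δ ^ 2) = bc N v / (C * Δ ^ 2) := by
      have := congrArg (· % M) hτ
      simpa [Nat.mul_add_mod', Nat.mod_eq_of_lt (hdiv N u), Nat.mod_eq_of_lt (hdiv N v)] using this
    have h2 : bc N u % (C * Δ ^ 2) = bc N v % (C * Δ ^ 2) := by simpa using hcol
    refine (hbspec N).2 u v huv.ne (mem_nodeBall_of_adj huv.symm) ?_
    rw [← Nat.div_add_mod (bc N u) (C * Δ ^ 2), h1, h2, Nat.div_add_mod]
  · rw [(hlspec N v).2.1]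
    constructor
    · intro h h0
      simp only [h0, Nat.sub_zero] at h
      exact absurd h (not_lt.2 (Nat.le_add_right _ _))
    · intro h
      have := (hlspec N v).1
      exact hlt N v D (by omega)
  · intro v hv
    obtain ⟨u, hvu, hu⟩ := (hlspec N v).2.2 fun h => hv ((hlspec N v).2.1.2 h)
    have := (hlspec N v).1
    refine ⟨u, hvu, (hlt N v (D - lev N u) (by omega)).trans_le (Nat.le_add_right _ _)⟩

/-- Ruling set and labels are common to all blocks. The block colorings run in parallel, so `q`
enters the number of rounds only through the radius. -/
theorem multicoloringInTime_roundCount {C T q : ℕ} (hC : 1 ≤ C) (hΔ : 3 ≤ Δ) (hq : 2 ≤ q)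
    (hexcl : Δ + 2 ≤ q → excl) (hA : ListColoringInTime c (C * Δ ^ 2) n Δ T) :
    MulticoloringInTime c n Δ (q * Δ) (q - 1) excl
      (roundCount c n Δ T (4 * Nat.clog Δ q)) := by
  set r := 4 * Nat.clog Δ q with hr
  set s := 2 * r + 2 with hs
  set b := colorBits c Δ s with hb
  obtain ⟨pc, hpc, hpspec⟩ := exists_powerColoring (c := c) (n := n) (Δ := Δ) (excl := excl) s
  obtain ⟨Z, hZ, hZspec⟩ := exists_rulingSet hpc fun N =>
    (hpspec N).mono (powerColors_le c Δ s)
  have hsep : ∀ N u v, Z N u → Z N v → u ∈ nodeBall N.G s v → u = v := fun N => (hZspec N).1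
  obtain ⟨lab, poor, hlab, hpoor, hlspec⟩ := exists_labels (r := r) (q := q) hZ
    fun N u v hu hv h => hsep N u v hu hv (nodeBall_mono (by omega) h)
  set R := s * (logStar n + 1) + b * s + 2 * r with hR
  have hRle : logStar n + 1 ≤ R := by
    have : 1 * (logStar n + 1) ≤ s * (logStar n + 1) := Nat.mul_le_mul_right _ (by omega)
    omega
  set D := sinkDist c Δ r with hD
  have key : ∀ i, ∃ g : (N : Net c n Δ excl) → N.V → ℕ,
      IsLocal (roundCount c n Δ T r) g ∧ (i ∈ Finset.Icc 1 q →
        ∀ N, (∀ v, g N v ∈ Finset.Icc 1 Δ) ∧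
          ∀ u v, N.G.Adj u v → lab N u ≠ i → lab N v ≠ i → g N u ≠ g N v) := by
    intro i
    by_cases hi : i ∈ Finset.Icc 1 q
    swap
    · exact ⟨fun _ _ => 0, isLocal_const _ _, fun h => absurd h hi⟩
    have hdead : IsLocal R fun N v => lab N v = i := hlab.map (· = i)
    have hsink : IsLocal R fun N v => poor N v ∨ lab N v = i := hpoor.map₂ hdead Or
    obtain ⟨τ, col, hτ, hcol, hspec⟩ := exists_schedule (C := C) (D := D) hC hΔ hRle hsink (by
      intro N v
      obtain ⟨u, hu, hZu⟩ := (hZspec N).2 v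
      rcases (hlspec N).2 u hZu with h | h
      · exact ⟨u, nodeBall_mono (Nat.le_add_right _ _) hu, Or.inl h⟩
      · obtain ⟨w, hw, hwi⟩ := h i hi
        exact ⟨w, nodeBall_trans hu hw, Or.inr hwi⟩)
    obtain ⟨f, hf, hfspec⟩ := exists_scheduledColoring (J := D * classCount c) (by omega) hA hτ hcol
      (fun N => (hspec N).1) (fun N => (hspec N).2.1)
      (fun N v hv => (hspec N).2.2.2 v (((hspec N).2.2.1 v).1 hv))
    obtain ⟨g, hg, hgspec⟩ := exists_filledColoring (r := r) hΔ hq hexcl le_rfl hf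
      (hdead.mono (by omega)) (hpoor.mono (by omega))
      (fun N u v hu hv h => hsep N u v ((hlspec N).1 u hu).1 ((hlspec N).1 v hv).1
        (nodeBall_mono (by omega) h)) (fun N v hv => ((hlspec N).1 v hv).2)
      (fun N => (hfspec N).1) (fun N u v huv hu hv hu' hv' => (hfspec N).2 u v huv
        (((hspec N).2.2.1 u).2 (not_or.2 ⟨hu', hu⟩)) (((hspec N).2.2.1 v).2 (not_or.2 ⟨hv', hv⟩)))
    exact ⟨g, hg, fun _ => hgspec⟩
  choose g hg hgspec using key
  have hlab' : IsLocal (roundCount c n Δ T r) lab := hlab.mono (by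
    show R ≤ R + D + D * classCount c * (T + 2) + (2 * r + 1)
    rw [Nat.add_assoc, Nat.add_assoc]
    exact Nat.le_add_right _ _)
  refine IsLocal.multicoloringInTime (hlab'.map₂ (IsLocal.pi hg) fun l g' =>
    ((Finset.Icc 1 q).erase l).image fun i => (i - 1) * Δ + g' i) fun N => ?_
  exact isMulticoloring_blocks fun i hi => hgspec i hi N

theorem multicoloringInTime_zero_of_card_le_one {p q : ℕ} (hn : n ≤ 1) (hqp : q ≤ p) :
    MulticoloringInTime c n Δ p q excl 0 := by
  refine IsLocal.multicoloringInTime (isLocal_const 0 (Finset.Icc 1 q)) fun N =>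
    ⟨fun _ => Finset.Icc_subset_Icc_right hqp, fun _ => by simp, fun u v huv => ?_⟩
  have : Fintype.card N.V ≤ 1 := by rw [N.isNetwork.card_eq]; exact hn
  exact absurd (Fintype.card_le_one_iff.1 this u v) huv.ne

theorem multicoloringInTime_zero (p : ℕ) : MulticoloringInTime c n Δ p 0 excl 0 :=
  IsLocal.multicoloringInTime (isLocal_const 0 ∅) fun _ =>
    ⟨fun _ => Finset.empty_subset _, fun _ => Nat.zero_le _, fun _ _ _ => Finset.disjoint_empty_left _⟩

theorem MulticoloringInTime.of_imp {p q R : ℕ} {excl' : Prop} (h : excl → excl')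
    (hM : MulticoloringInTime c n Δ p q excl R) : MulticoloringInTime c n Δ p q excl' R := by
  obtain ⟨A, hA⟩ := hM
  exact ⟨A, fun V _ G _ ident hN hfree => hA V G ident hN fun he => hfree (h he)⟩

end Assembly

/-! ### List coloring takes at least one round -/

/-- Without communication, the ends of a single edge choose from their own lists. No color lies in
all of `{0, 1}`, `{0, 2}`, `{1, 2}`, so each end uses at least two of the three colors, and for some
pair of lists the choices coincide. -/
theorem one_le_of_listColoringInTime {c m n Δ T : ℕ} (hc : 1 ≤ c) (hm : 2 ≤ m) (hΔ : 1 ≤ Δ)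
    (hn : 2 ≤ n) (h : ListColoringInTime c m n Δ T) : 1 ≤ T := by
  classical
  by_contra hT
  have hT0 : T = 0 := by omega
  subst hT0
  obtain ⟨A, hA⟩ := h
  let G : SimpleGraph (Fin n) :=
    { Adj := fun u v => (u.val = 0 ∧ v.val = 1) ∨ (u.val = 1 ∧ v.val = 0)
      symm := ⟨fun _ _ h => h.symm.imp And.symm And.symm⟩
      loopless := ⟨fun _ h => by rcases h with h | h <;> omega⟩ }
  have hdeg : ∀ v, G.degree v ≤ 1 := by
    intro v
    rw [← SimpleGraph.card_neighborFinset_eq_degree]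
    refine Finset.card_le_one.2 fun a ha b hb => ?_
    rw [SimpleGraph.mem_neighborFinset] at ha hb
    refine Fin.ext ?_
    rcases ha with ha | ha <;> rcases hb with hb | hb <;> omega
  let v₀ : Fin n := ⟨0, by omega⟩
  let v₁ : Fin n := ⟨1, by omega⟩
  have hnet : IsNetwork c n Δ G fun v => v.val + 1 :=
    { card_eq := Fintype.card_fin n
      maxDegree_le := SimpleGraph.maxDegree_le_of_forall_degree_le _ _ fun v => (hdeg v).trans hΔ
      ident_mem := fun v => by
        have h1 : n ≤ n ^ c := Nat.le_self_pow (by omega) n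
        have h2 := v.isLt
        rw [Finset.mem_Icc]
        omega
      ident_injective := fun u v h => Fin.ext (by simpa using h) }
  have key : ∀ L₀ L₁ : Finset ℕ, L₀.card = 2 → L₁.card = 2 →
      let x := A.output (A.init n Δ 1 (G.degree v₀) (1, L₀))
      let y := A.output (A.init n Δ 2 (G.degree v₁) (2, L₁))
      x ∈ L₀ ∧ y ∈ L₁ ∧ x ≠ y := by
    intro L₀ L₁ h₀ h₁
    have := hA (Fin n) G (fun v => v.val + 1) (fun v => if v.val = 0 then 1 else 2)
      (fun v => if v.val = 0 then L₀ else L₁) hnet ⟨fun v => ?_, fun u v huv => ?_⟩ fun v => ?_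
    · exact ⟨this.1 v₀, this.1 v₁, this.2 v₀ v₁ (Or.inl ⟨rfl, rfl⟩)⟩
    · simp only [Finset.mem_Icc]
      split_ifs <;> omega
    · rcases huv with h | h <;> simp [h.1, h.2]
    · have := hdeg v
      split_ifs <;> omega
  have k₁ := key {0, 1} {0, 1} rfl rfl
  have k₂ := key {0, 1} {0, 2} rfl rfl
  have k₃ := key {0, 1} {1, 2} rfl rfl
  have k₄ := key {0, 2} {0, 1} rfl rfl
  have k₅ := key {0, 2} {0, 2} rfl rfl
  have k₆ := key {0, 2} {1, 2} rfl rfl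
  have k₇ := key {1, 2} {0, 1} rfl rfl
  have k₈ := key {1, 2} {0, 2} rfl rfl
  have k₉ := key {1, 2} {1, 2} rfl rfl
  simp only [Finset.mem_insert, Finset.mem_singleton] at k₁ k₂ k₃ k₄ k₅ k₆ k₇ k₈ k₉
  omega

/-! ### Round bounds -/

theorem one_le_log_of_three_le {Δ : ℕ} (hΔ : 3 ≤ Δ) : 1 ≤ Real.log Δ := by
  rw [Real.le_log_iff_exp_le (by positivity)]
  have h1 := Real.exp_one_lt_d9
  have h2 : (3 : ℝ) ≤ Δ := by exact_mod_cast hΔ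
  linarith

theorem clog_succ_le_log {Δ : ℕ} (hΔ : 3 ≤ Δ) : (Nat.clog 2 (Δ + 1) : ℝ) ≤ 5 * Real.log Δ := by
  have h1 := clog_two_le (Δ + 1) (by omega)
  have h2 := one_le_log_of_three_le hΔ
  have h3 : Real.log ((Δ + 1 : ℕ) : ℝ) ≤ 2 * Real.log Δ := by
    rw [← Real.log_rpow (by positivity)]
    refine Real.log_le_log (by positivity) ?_
    have h4 : (3 : ℝ) ≤ Δ := by exact_mod_cast hΔ
    rw [Real.rpow_two]
    push_cast
    nlinarith
  have h5 : Real.logb 2 ((Δ + 1 : ℕ) : ℝ) ≤ 4 * Real.log Δ := by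
    rw [Real.logb, div_le_iff₀ (Real.log_pos one_lt_two)]
    have := Real.log_two_gt_d9
    nlinarith
  linarith

/-- The constant in the bound on the number of bits. -/
noncomputable def bitsConst (c : ℕ) : ℝ := 106 + 2 * Nat.clog 2 (lengthConst c)

/-- The constant in the bound on the number of rounds. -/
noncomputable def roundConst (c : ℕ) : ℝ :=
  41 + 20 * bitsConst c + 3 * classCount c * (10 * bitsConst c + 4)

theorem roundCount_le {c n Δ T a : ℕ} (hΔ : 3 ≤ Δ) (hT : 1 ≤ T) (hn : 1 ≤ logStar n) (ha : 1 ≤ a) :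
    (roundCount c n Δ T (4 * a) : ℝ) ≤
      roundConst c * ((a : ℝ) ^ 2 * Real.log Δ * T + a * logStar n) := by
  have hl := one_le_log_of_three_le hΔ
  set l := Real.log Δ with hldef
  have ha' : (1 : ℝ) ≤ a := by exact_mod_cast ha
  have hT' : (1 : ℝ) ≤ T := by exact_mod_cast hT
  have hn' : (1 : ℝ) ≤ logStar n := by exact_mod_cast hn
  set B := bitsConst c with hB
  have hB0 : 106 ≤ B := by
    rw [hB, bitsConst]
    linarith [(Nat.cast_nonneg (Nat.clog 2 (lengthConst c)) : (0 : ℝ) ≤ _)]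
  have hal : 1 ≤ (a : ℝ) * l := one_le_mul_of_one_le_of_one_le ha' hl
  have hs : ((2 * (4 * a) + 2 : ℕ) : ℝ) ≤ 10 * a := by push_cast; linarith
  have hbits : (colorBits c Δ (2 * (4 * a) + 2) : ℝ) ≤ B * (a * l) := by
    rw [colorBits, hB, bitsConst]
    push_cast
    have h1 := clog_succ_le_log hΔ
    rw [← hldef] at h1
    have h2 : (0 : ℝ) ≤ Nat.clog 2 (lengthConst c) := Nat.cast_nonneg _
    have h3 : 2 * (2 * (4 * (a : ℝ)) + 2) * (Nat.clog 2 (Δ + 1) : ℝ) ≤ 2 * (10 * a) * (5 * l) := by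
      gcongr
      linarith
    nlinarith
  set W : ℝ := (a : ℝ) ^ 2 * l with hW
  have haW : (a : ℝ) ≤ W := by rw [hW]; nlinarith
  have hW1 : 1 ≤ W := ha'.trans haW
  have hbs : ((colorBits c Δ (2 * (4 * a) + 2) * (2 * (4 * a) + 2) : ℕ) : ℝ) ≤ 10 * B * W := by
    rw [Nat.cast_mul]
    calc _ ≤ B * (a * l) * (10 * a) := by gcongr
      _ = 10 * B * W := by rw [hW]; ring
  have hD : (sinkDist c Δ (4 * a) : ℝ) ≤ (10 * B + 4) * W := by
    rw [sinkDist, Nat.cast_add]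
    push_cast at hbs ⊢
    linarith
  set M : ℝ := (classCount c : ℝ) with hM
  have hM0 : 0 ≤ M := Nat.cast_nonneg _
  have hDM : (sinkDist c Δ (4 * a) : ℝ) * M * (T + 2) ≤ (10 * B + 4) * W * M * (3 * T) := by
    gcongr
    linarith
  have hWT : W ≤ W * T := le_mul_of_one_le_right (by linarith) hT'
  have hfirst : ((2 * (4 * a) + 2 : ℕ) : ℝ) * (logStar n + 1) ≤ 10 * a * (2 * logStar n) := by
    gcongr
    linarith
  have haln : 0 ≤ (a : ℝ) * logStar n := by positivity
  have hWT0 : 0 ≤ W * T := by positivity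
  have hP : 0 ≤ 3 * M * (10 * B + 4) := by positivity
  have htotal : (roundCount c n Δ T (4 * a) : ℝ) ≤ 20 * (a * logStar n) +
      (10 * B * W + 8 * W + (10 * B + 4) * W + (10 * B + 4) * W * M * (3 * T) + 9 * W) := by
    rw [roundCount]
    push_cast at hfirst hbs hDM ⊢
    linarith
  have h1 : 10 * B * W + 8 * W + (10 * B + 4) * W + 9 * W ≤ (20 * B + 21) * (W * T) := by
    have : (20 * B + 21) * W ≤ (20 * B + 21) * (W * T) :=
      mul_le_mul_of_nonneg_left hWT (by linarith)
    linarith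
  rw [roundConst, ← hB, ← hM]
  have h2 : 0 ≤ (20 * B + 21 + 3 * M * (10 * B + 4)) * (a * logStar n) := by positivity
  linarith

theorem le_roundConst (c : ℕ) : 41 ≤ roundConst c := by
  have h1 : 0 ≤ bitsConst c := by rw [bitsConst]; positivity
  have h2 : 0 ≤ 3 * (classCount c : ℝ) * (10 * bitsConst c + 4) := by positivity
  rw [roundConst]
  linarith

theorem exists_multicoloringInTime {c C n Δ T q : ℕ} (hc : 1 ≤ c) (hC : 1 ≤ C) (hΔ : 3 ≤ Δ)
    (hA : ListColoringInTime c (C * Δ ^ 2) n Δ T) (hq : 0 < q) : ∃ R : ℕ,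
      (R : ℝ) ≤ roundConst c * ((1 + Real.logb Δ q) ^ 2 * Real.log Δ * T
        + (1 + Real.logb Δ q) * logStar n) ∧
      MulticoloringInTime c n Δ (q * Δ) (q - 1) (Δ + 2 ≤ q) R := by
  have hΔ1 : (1 : ℝ) < Δ := by exact_mod_cast (show 1 < Δ by omega)
  have hl := one_le_log_of_three_le hΔ
  have hlogb : 0 ≤ Real.logb Δ q := Real.logb_nonneg hΔ1 (by exact_mod_cast hq)
  have hK := le_roundConst c
  have hpos : (0 : ℝ) ≤ roundConst c * ((1 + Real.logb Δ q) ^ 2 * Real.log Δ * T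
      + (1 + Real.logb Δ q) * logStar n) := by
    have : 0 ≤ Real.log Δ := by linarith
    positivity
  -- The cases `n ≤ 1` and `q = 1` need no round; in all others `logStar n` and `T` are at least
  -- `1`, which absorbs the additive constants.
  by_cases hn : n ≤ 1
  · refine ⟨0, by simpa using hpos, multicoloringInTime_zero_of_card_le_one hn ?_⟩
    have : q * 1 ≤ q * Δ := Nat.mul_le_mul_left q (by omega)
    omega
  by_cases hq1 : q = 1
  · subst hq1
    exact ⟨0, by simpa using hpos, multicoloringInTime_zero _⟩
  have hT : 1 ≤ T := one_le_of_listColoringInTime hc (by nlinarith) (by omega) (by omega) hA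
  refine ⟨roundCount c n Δ T (4 * Nat.clog Δ q), ?_,
    multicoloringInTime_roundCount hC hΔ (by omega) id hA⟩
  have ha : 1 ≤ Nat.clog Δ q := Nat.clog_pos (by omega) (by omega)
  refine (roundCount_le hΔ hT (one_le_logStar (by omega)) ha).trans ?_
  have haα : (Nat.clog Δ q : ℝ) ≤ 1 + Real.logb Δ q := by
    rw [← Real.natCeil_logb_natCast, add_comm]
    exact (Nat.ceil_lt_add_one hlogb).le
  have hl0 : 0 ≤ Real.log Δ := by linarith
  gcongr

theorem mainTheorem2 (c C : ℕ) (hc : 1 ≤ c) (hC : 1 ≤ C) :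
    ∃ K : ℝ, 0 < K ∧ ∀ n Δ T : ℕ, 3 ≤ Δ → ListColoringInTime c (C * Δ ^ 2) n Δ T →
      (∀ q : ℕ, 0 < q → ∃ R : ℕ,
        (R : ℝ) ≤ K * ((1 + Real.logb Δ q) ^ 2 * Real.log Δ * T
          + (1 + Real.logb Δ q) * logStar n) ∧
        MulticoloringInTime c n Δ (q * Δ) (q - 1) (Δ + 2 ≤ q) R) ∧
      (∀ ε : ℝ, 0 < ε → ε ≤ Δ → ∃ q R : ℕ, 2 ≤ q ∧
        (Δ : ℝ) / ε ≤ q ∧ (q : ℝ) ≤ K * (Δ / ε) ∧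
        ((q * Δ : ℕ) : ℝ) / ((q - 1 : ℕ) : ℝ) ≤ Δ + ε ∧
        ((q * Δ : ℕ) : ℝ) ≤ K * (Δ ^ 2 / ε) ∧
        (R : ℝ) ≤ K * ((Real.log Δ + Real.posLog (1 / ε) ^ 2 / Real.log Δ) * T
          + (1 + Real.posLog (1 / ε) / Real.log Δ) * logStar n) ∧
        MulticoloringInTime c n Δ (q * Δ) (q - 1) (ε < 1) R) := by
  have hK := le_roundConst c
  -- The factor is `2 * 3 ^ 2`, from `α ≤ 3 * (1 + p / l)` and `(1 + y) ^ 2 ≤ 2 * (1 + y ^ 2)`.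
  refine ⟨18 * roundConst c, by linarith, fun n Δ T hΔ hA => ⟨fun q hq => ?_, fun ε hε hεΔ => ?_⟩⟩
  · obtain ⟨R, hR, hM⟩ := exists_multicoloringInTime hc hC hΔ hA hq
    refine ⟨R, hR.trans ?_, hM⟩
    have hΔ1 : (1 : ℝ) < Δ := by exact_mod_cast (show 1 < Δ by omega)
    have hlogb : 0 ≤ Real.logb Δ q := Real.logb_nonneg hΔ1 (by exact_mod_cast hq)
    have hl0 : 0 ≤ Real.log Δ := by linarith [one_le_log_of_three_le hΔ]
    refine mul_le_mul_of_nonneg_right (by linarith) (by positivity)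
  have hΔ3 : (3 : ℝ) ≤ Δ := by exact_mod_cast hΔ
  have hl := one_le_log_of_three_le hΔ
  set x : ℝ := Δ / ε with hx
  have hx1 : 1 ≤ x := by rw [hx, le_div_iff₀ hε]; linarith
  have hx0 : 0 < x := by linarith
  -- With this choice `q * Δ / (q - 1) = Δ + Δ / ⌈Δ / ε⌉₊`, which is at most `Δ + ε`. Moreover `ε ≥
  -- 1` gives `q ≤ Δ + 1`, so cliques need not be excluded then.
  set q := ⌈x⌉₊ + 1 with hq
  have hceil1 : x ≤ ⌈x⌉₊ := Nat.le_ceil x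
  have hceil2 : (⌈x⌉₊ : ℝ) < x + 1 := Nat.ceil_lt_add_one hx0.le
  have hceil0 : 1 ≤ ⌈x⌉₊ := Nat.one_le_ceil_iff.2 hx0
  have hq1 : (q : ℝ) = ⌈x⌉₊ + 1 := by rw [hq]; push_cast; ring
  have hq3 : (q : ℝ) ≤ 3 * x := by linarith
  obtain ⟨R, hR, hM⟩ := exists_multicoloringInTime hc hC hΔ hA (show 0 < q by omega)
  refine ⟨q, R, by omega, by linarith, by nlinarith, ?_, ?_, ?_, ?_⟩
  · rw [show q - 1 = ⌈x⌉₊ by omega]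
    have hc0 : (0 : ℝ) < ⌈x⌉₊ := by linarith
    rw [div_le_iff₀ hc0, Nat.cast_mul, hq1]
    have : (Δ : ℝ) ≤ ε * ⌈x⌉₊ := by
      rw [hx, div_le_iff₀ hε] at hceil1
      linarith
    linarith
  · have : (Δ : ℝ) ^ 2 / ε = x * Δ := by rw [hx]; ring
    rw [this, Nat.cast_mul, ← mul_assoc]
    refine mul_le_mul_of_nonneg_right ?_ (by linarith)
    nlinarith
  · refine hR.trans ?_
    set l := Real.log Δ with hldef
    set p := Real.posLog (1 / ε) with hp
    have hp0 : 0 ≤ p := Real.posLog_nonneg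
    have hα0 : 0 ≤ Real.logb Δ q :=
      Real.logb_nonneg (by linarith) (by exact_mod_cast (show 1 ≤ q by omega))
    have hlogq : Real.log q ≤ l + l + p := by
      have h1 : Real.log q ≤ Real.log (3 * x) := Real.log_le_log (by linarith) hq3
      have h2 : Real.log (3 * x) = Real.log 3 + (l + Real.log (1 / ε)) := by
        rw [Real.log_mul (by norm_num) hx0.ne', hx, div_eq_mul_one_div,
          Real.log_mul (by positivity) (by positivity)]
      have h3 : Real.log 3 ≤ l := Real.log_le_log (by norm_num) hΔ3
      have h4 : Real.log (1 / ε) ≤ p := le_max_right _ _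
      linarith
    have hα : 1 + Real.logb Δ q ≤ 3 * (1 + p / l) := by
      have h1 : Real.logb Δ q ≤ 2 + p / l := by
        rw [Real.logb, div_le_iff₀ (by linarith), add_mul, div_mul_cancel₀ _ (by linarith)]
        linarith
      have h2 : 0 ≤ p / l := by positivity
      linarith
    have hsq : (1 + Real.logb Δ q) ^ 2 * l ≤ 18 * (l + p ^ 2 / l) := by
      have h1 : (1 + Real.logb Δ q) ^ 2 ≤ (3 * (1 + p / l)) ^ 2 := by gcongr
      have h2 : (3 * (1 + p / l)) ^ 2 ≤ 18 * (1 + (p / l) ^ 2) := by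
        nlinarith [sq_nonneg (1 - p / l)]
      calc (1 + Real.logb Δ q) ^ 2 * l ≤ 18 * (1 + (p / l) ^ 2) * l :=
            mul_le_mul_of_nonneg_right (h1.trans h2) (by linarith)
        _ = 18 * (l + p ^ 2 / l) := by
            field_simp
    have hls : (0 : ℝ) ≤ logStar n := Nat.cast_nonneg _
    have hT0 : (0 : ℝ) ≤ T := Nat.cast_nonneg _
    have h1 : (1 + Real.logb Δ q) ^ 2 * l * T ≤ 18 * (l + p ^ 2 / l) * T :=
      mul_le_mul_of_nonneg_right hsq hT0
    have h2 : (1 + Real.logb Δ q) * logStar n ≤ 18 * ((1 + p / l) * logStar n) := by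
      have h3 : (1 + Real.logb Δ q) * logStar n ≤ 3 * (1 + p / l) * logStar n :=
        mul_le_mul_of_nonneg_right hα hls
      have h4 : 0 ≤ (1 + p / l) * logStar n := by positivity
      linarith
    calc _ ≤ roundConst c * (18 * (l + p ^ 2 / l) * T + 18 * ((1 + p / l) * logStar n)) :=
          mul_le_mul_of_nonneg_left (add_le_add h1 h2) (by linarith)
      _ = _ := by ring
  · refine hM.of_imp fun hqΔ => ?_
    by_contra hε1
    push Not at hε1
    have h1 : x ≤ Δ := by rw [hx]; exact div_le_self (by linarith) hε1
    have h2 : ⌈x⌉₊ ≤ Δ := Nat.ceil_le.2 h1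
    omega
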